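/- Let $A$ be a commutative, unital, complex Banach algebra and let $\mathcal U$ be a set of monic polynomials of degree at least $1$ over $A$. For each $\alpha=a_0+\dots+a_{n-1}x^{n-1}+x^n\in\mathcal U$ (with $n=n(\alpha)$) fix a number $t_\alpha>0$ with $t_\alpha^{\,n}\ge\sum_{k<n}\|a_k\|t_\alpha^{\,k}$. *Arens–Hoffman extensions.* If $C\supseteq A$ is a commutative normed algebra containing $A$ isometrically and $\alpha\in\mathcal U$, the Arens–Hoffman extension of $C$ by $\alpha$ is $C[x]/(\alpha(x))$ with the norm $\bigl\|\sum_{k<n}b_k\bar x^k\bigr\|=\sum_{k<n}\|b_k\|t_\alpha^{\,k}$ $(b_k\in C)$. *Standard extensions.* Let $\mathcal U$ be well-ordered. A standard extension $B_{\mathcal U}$ of $A$ is a commutative normed algebra containing $A$ isometrically, together with an increasing family of subalgebras $(B_\alpha)_{\alpha\in\mathcal U}$ which contain $A$ and have union $B_{\mathcal U}$ ($B_{\mathcal U}=A$ if $\mathcal U=\emptyset$), and, for each $\beta\in\mathcal U$, an isometric isomorphism $\psi_\beta$ from the Arens–Hoffman extension of $B_{<\beta}$ by $\beta$ onto $B_\beta$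 which fixes $B_{<\beta}$; here $B_{<\beta}=\bigcup_{\alpha<\beta}B_\alpha$ if $\beta$ is not the least element of $\mathcal U$, and $B_{<\beta}=A$ if it is. Write $\xi_\beta=\psi_\beta(\bar x)$. *Narmania extension.* For a finite set $S\subseteq\mathcal U$ let $A_S=A[x_\alpha:\alpha\in S]/(\alpha(x_\alpha):\alpha\in S)$. Each class has a unique representative $\sum_s q_sx^s$ of degree less than $n(\alpha)$ in $x_\alpha$ for every $\alpha\in S$, and the class is given the norm $\sum_s\|q_s\|\prod_{\alpha\in S}t_\alpha^{s_\alpha}$. The Narmania extension $A_{\mathcal U}$ is the completion of the direct limit of the normed algebras $A_S$ under the natural maps $A_S\to A_T$ $(S\subseteq T)$. Write $y_\alpha$ for the image of $x_\alpha$ in $A_{\mathcal U}$. *Gelfand transforms.* For a commutative, unital normed algebra $B$ let $\Omega(B)$ be the compact space of non-zero continuous characters of $B$, let $\hat b(\omega)=\omega(b)$, and let $\overline{\hat B}$ be the closure of $\{\hat b:b\in B\}$ in $C(\Omega(B))$ with respect to the supremum norm. *Cole extension.* If $A\subseteq C(X)$ is a uniform algebra on a compact Hausdorff space $X$ (a closed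 subalgebra that contains the constants and separates points), let $X^{\mathcal U}$ be the compact space of all $(\kappa,\lambda)\in X\times\mathbb C^{\mathcal U}$ with $\sum_{k<n}a_k(\kappa)\lambda_\alpha^{\,k}+\lambda_\alpha^{\,n}=0$ for every $\alpha=a_0+\dots+a_{n-1}x^{n-1}+x^n\in\mathcal U$. The Cole extension $A^{\mathcal U}$ is the closed subalgebra of $C(X^{\mathcal U})$ generated by the functions $(\kappa,\lambda)\mapsto f(\kappa)$, $f\in A$, and $p_\alpha\colon(\kappa,\lambda)\mapsto\lambda_\alpha$, $\alpha\in\mathcal U$. **Proposition.** (1) For every well-ordering of $\mathcal U$ a standard extension exists, and for every standard extension $B_{\mathcal U}$ there is an isometric algebra isomorphism from its completion $\widetilde{B_{\mathcal U}}$ onto $A_{\mathcal U}$ which is the identity on $A$ and maps $\xi_\alpha$ to $y_\alpha$ for every $\alpha\in\mathcal U$. (2) If $A$ is a uniform algebra on $X$, then, up to isometric isomorphism, $A^{\mathcal U}=\overline{(A_{\mathcal U})\hat{\ }}=\overline{(B_{\mathcal U})\hat{\ }}$ for every standard extension $B_{\mathcal U}$. More precisely, there are isometric algebra isomorphisms from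 $A^{\mathcal U}$ onto $\overline{(A_{\mathcal U})\hat{\ }}$ and onto $\overline{(B_{\mathcal U})\hat{\ }}$ which map (the image of) each $f\in A$ to $\hat f$, and map $p_\alpha$ to $\hat y_\alpha$ and to $\hat\xi_\alpha$ respectively, for every $\alpha\in\mathcal U$. -/

import Mathlib

universe u v w

noncomputable section

namespace AlgExt

section Weighted

variable {A : Type u} [NormedCommRing A] {σ : Type v}

/-- The norm `∑ s, ‖q_s‖ t^s` of a polynomial `q = ∑ s, q_s x^s` in the indeterminates `σ`. -/
def weightedNorm (t : σ → ℝ) (q : MvPolynomial σ A) : ℝ :=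
  ∑ s ∈ q.support, ‖q.coeff s‖ * s.prod fun i k => t i ^ k

theorem weightedNorm_eq_of_subset (t : σ → ℝ) (q : MvPolynomial σ A) (F : Finset (σ →₀ ℕ))
    (hF : q.support ⊆ F) :
    weightedNorm t q = ∑ s ∈ F, ‖q.coeff s‖ * s.prod fun i k => t i ^ k := by
  refine Finset.sum_subset hF fun s _ hs => ?_
  rw [MvPolynomial.notMem_support_iff.1 hs, norm_zero, zero_mul]

theorem monomialWeight_nonneg {t : σ → ℝ} (ht : ∀ i, 0 < t i) (s : σ →₀ ℕ) :
    0 < s.prod fun i k => t i ^ k :=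
  Finset.prod_pos fun i _ => pow_pos (ht i) _

theorem weightedNorm_nonneg {t : σ → ℝ} (ht : ∀ i, 0 < t i) (q : MvPolynomial σ A) :
    0 ≤ weightedNorm t q :=
  Finset.sum_nonneg fun s _ => mul_nonneg (norm_nonneg _) (monomialWeight_nonneg ht s).le

theorem weightedNorm_zero (t : σ → ℝ) : weightedNorm t (0 : MvPolynomial σ A) = 0 := by
  simp [weightedNorm]

theorem weightedNorm_neg (t : σ → ℝ) (q : MvPolynomial σ A) :
    weightedNorm t (-q) = weightedNorm t q := by
  simp [weightedNorm, MvPolynomial.support_neg]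

theorem weightedNorm_monomial (t : σ → ℝ) (s : σ →₀ ℕ) (a : A) :
    weightedNorm t (MvPolynomial.monomial s a) = ‖a‖ * s.prod fun i k => t i ^ k := by
  classical
  rw [weightedNorm_eq_of_subset t _ {s} MvPolynomial.support_monomial_subset]
  simp

theorem weightedNorm_add_le {t : σ → ℝ} (ht : ∀ i, 0 < t i) (p q : MvPolynomial σ A) :
    weightedNorm t (p + q) ≤ weightedNorm t p + weightedNorm t q := by
  classical
  rw [weightedNorm_eq_of_subset t _ (p.support ∪ q.support) MvPolynomial.support_add,
    weightedNorm_eq_of_subset t p (p.support ∪ q.support) Finset.subset_union_left,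
    weightedNorm_eq_of_subset t q (p.support ∪ q.support) Finset.subset_union_right,
    ← Finset.sum_add_distrib]
  refine Finset.sum_le_sum fun s _ => ?_
  rw [← add_mul, MvPolynomial.coeff_add]
  exact mul_le_mul_of_nonneg_right (norm_add_le _ _) (monomialWeight_nonneg ht s).le

theorem weightedNorm_sum_le {t : σ → ℝ} (ht : ∀ i, 0 < t i) {ι : Type*} (F : Finset ι)
    (p : ι → MvPolynomial σ A) :
    weightedNorm t (∑ j ∈ F, p j) ≤ ∑ j ∈ F, weightedNorm t (p j) := by
  classical
  induction F using Finset.induction_on with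
  | empty => simp [weightedNorm_zero]
  | insert a F ha ih =>
    rw [Finset.sum_insert ha, Finset.sum_insert ha]
    exact (weightedNorm_add_le ht _ _).trans (by gcongr)

theorem weightedNorm_mul_le {t : σ → ℝ} (ht : ∀ i, 0 < t i) (p q : MvPolynomial σ A) :
    weightedNorm t (p * q) ≤ weightedNorm t p * weightedNorm t q := by
  classical
  have h : p * q = ∑ s ∈ p.support, ∑ s' ∈ q.support,
      MvPolynomial.monomial (s + s') (p.coeff s * q.coeff s') := by
    conv_lhs => rw [p.as_sum, q.as_sum]
    rw [Finset.sum_mul_sum]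
    simp only [MvPolynomial.monomial_mul]
  rw [h]
  refine (weightedNorm_sum_le ht _ _).trans ?_
  rw [weightedNorm, weightedNorm, Finset.sum_mul_sum]
  refine Finset.sum_le_sum fun s _ => (weightedNorm_sum_le ht _ _).trans ?_
  refine Finset.sum_le_sum fun s' _ => ?_
  rw [weightedNorm_monomial, Finsupp.prod_add_index' (by simp) (by intros; rw [pow_add])]
  have h1 := (monomialWeight_nonneg ht s).le
  have h2 := (monomialWeight_nonneg ht s').le
  calc ‖p.coeff s * q.coeff s'‖ * ((s.prod fun i k => t i ^ k) * s'.prod fun i k => t i ^ k)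
      ≤ (‖p.coeff s‖ * ‖q.coeff s'‖) *
        ((s.prod fun i k => t i ^ k) * s'.prod fun i k => t i ^ k) := by
        gcongr
        exact norm_mul_le _ _
    _ = _ := by ring

theorem weightedNorm_smul_le {𝕜 : Type*} [NormedField 𝕜] [NormedAlgebra 𝕜 A] {t : σ → ℝ}
    (ht : ∀ i, 0 < t i) (c : 𝕜) (q : MvPolynomial σ A) :
    weightedNorm t (c • q) ≤ ‖c‖ * weightedNorm t q := by
  classical
  rw [weightedNorm_eq_of_subset t (c • q) q.support MvPolynomial.support_smul, weightedNorm,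
    Finset.mul_sum]
  refine Finset.sum_le_sum fun s _ => ?_
  rw [MvPolynomial.coeff_smul, ← mul_assoc]
  exact mul_le_mul_of_nonneg_right (norm_smul_le _ _) (monomialWeight_nonneg ht s).le

theorem eq_zero_of_weightedNorm {t : σ → ℝ} (ht : ∀ i, 0 < t i) {q : MvPolynomial σ A}
    (h : weightedNorm t q = 0) : q = 0 := by
  ext s
  by_contra hs
  have hs' : s ∈ q.support := MvPolynomial.mem_support_iff.2 hs
  have := (Finset.sum_eq_zero_iff_of_nonneg (fun s _ =>
    mul_nonneg (norm_nonneg (q.coeff s)) (monomialWeight_nonneg ht s).le)).1 h s hs'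
  rcases mul_eq_zero.1 this with h1 | h1
  · exact hs (norm_eq_zero.1 h1)
  · exact (monomialWeight_nonneg ht s).ne' h1

theorem weightedNorm_rename {τ : Type*} {g : σ → τ} (hg : Function.Injective g)
    (t : τ → ℝ) (q : MvPolynomial σ A) :
    weightedNorm t (MvPolynomial.rename g q) = weightedNorm (t ∘ g) q := by
  classical
  rw [weightedNorm, MvPolynomial.support_rename_of_injective hg, weightedNorm,
    Finset.sum_image (fun a _ b _ h => Finsupp.mapDomain_injective hg h)]
  refine Finset.sum_congr rfl fun s _ => ?_
  rw [MvPolynomial.coeff_rename_mapDomain g hg, Finsupp.prod_mapDomain_index_inj hg]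
  rfl

end Weighted

section Minimal

variable {A : Type u} [CommRing A] {σ : Type v}

/-- The ideal generated by the polynomials `f i (x_i)`, each in its own indeterminate. -/
def relIdeal (f : σ → Polynomial A) : Ideal (MvPolynomial σ A) :=
  Ideal.span (Set.range fun i => Polynomial.aeval (MvPolynomial.X i) (f i))

/-- A polynomial is minimal if its degree in `x_i` is less than the degree of `f i`, for all `i`. -/
def IsMinimal (f : σ → Polynomial A) (q : MvPolynomial σ A) : Prop :=
  ∀ i, q.degreeOf i < (f i).natDegree

/-- Replace every power `x_i ^ k` by its remainder modulo `f i (x_i)`. -/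
def reduce (f : σ → Polynomial A) : MvPolynomial σ A →ₗ[A] MvPolynomial σ A :=
  (MvPolynomial.basisMonomials σ A).constr A fun s =>
    s.prod fun i k => Polynomial.aeval (MvPolynomial.X i) (Polynomial.X ^ k %ₘ f i)

variable {f : σ → Polynomial A}

theorem reduce_monomial (s : σ →₀ ℕ) (a : A) :
    reduce f (MvPolynomial.monomial s a) = a • s.prod fun i k =>
      (Polynomial.aeval (MvPolynomial.X i) (Polynomial.X ^ k %ₘ f i) : MvPolynomial σ A) := by
  have h : MvPolynomial.monomial s a = a • (MvPolynomial.basisMonomials σ A s) := by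
    simp [MvPolynomial.smul_monomial]
  rw [h, map_smul, reduce, Module.Basis.constr_basis]

theorem X_pow_modByMonic {p : Polynomial A} (hp : p.Monic) {k : ℕ} (hk : k < p.natDegree) :
    (Polynomial.X ^ k : Polynomial A) %ₘ p = Polynomial.X ^ k := by
  nontriviality A
  rw [Polynomial.modByMonic_eq_self_iff hp, Polynomial.degree_X_pow,
    Polynomial.degree_eq_natDegree hp.ne_zero]
  exact_mod_cast hk

theorem reduce_of_isMinimal (hf : ∀ i, (f i).Monic ∧ 0 < (f i).natDegree)
    {q : MvPolynomial σ A} (hq : IsMinimal f q) : reduce f q = q := by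
  conv_rhs => rw [q.as_sum]
  conv_lhs => rw [q.as_sum]
  rw [map_sum]
  refine Finset.sum_congr rfl fun s hs => ?_
  have hs' : ∀ i, s i < (f i).natDegree := fun i =>
    (MvPolynomial.degreeOf_lt_iff (hf i).2).1 (hq i) s hs
  rw [reduce_monomial, MvPolynomial.monomial_eq, MvPolynomial.smul_eq_C_mul]
  congr 1
  refine Finset.prod_congr rfl fun i _ => ?_
  simp only [X_pow_modByMonic (hf i).1 (hs' i), map_pow, Polynomial.aeval_X]

theorem degreeOf_aeval_le [DecidableEq σ] (i j : σ) (p : Polynomial A) :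
    (Polynomial.aeval (MvPolynomial.X j : MvPolynomial σ A) p).degreeOf i ≤
      if i = j then p.natDegree else 0 := by
  rw [Polynomial.aeval_eq_sum_range]
  refine (MvPolynomial.degreeOf_sum_le _ _ _).trans (Finset.sup_le fun k hk => ?_)
  rw [MvPolynomial.smul_eq_C_mul]
  refine (MvPolynomial.degreeOf_C_mul_le _ _ _).trans ?_
  split_ifs with h
  · subst h
    refine (MvPolynomial.degreeOf_pow_le _ _ _).trans ?_
    have : (MvPolynomial.X i : MvPolynomial σ A).degreeOf i ≤ 1 := by
      rcases subsingleton_or_nontrivial A with h | h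
      · rw [Subsingleton.elim (MvPolynomial.X i : MvPolynomial σ A) 0, MvPolynomial.degreeOf_zero]
        exact Nat.zero_le 1
      · rw [MvPolynomial.degreeOf_X_self]
    have hk' : k ≤ p.natDegree := Nat.lt_succ_iff.1 (Finset.mem_range.1 hk)
    nlinarith
  · rw [MvPolynomial.degreeOf_X_pow_of_ne k h]

theorem isMinimal_reduce (hf : ∀ i, (f i).Monic ∧ 0 < (f i).natDegree) (q : MvPolynomial σ A) :
    IsMinimal f (reduce f q) := by
  classical
  intro i
  rw [q.as_sum, map_sum]
  refine lt_of_le_of_lt (MvPolynomial.degreeOf_sum_le _ _ _) ?_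
  rw [Finset.sup_lt_iff (by simpa using (hf i).2)]
  intro s _
  rw [reduce_monomial, MvPolynomial.smul_eq_C_mul]
  refine lt_of_le_of_lt (MvPolynomial.degreeOf_C_mul_le _ _ _) ?_
  refine lt_of_le_of_lt (MvPolynomial.degreeOf_prod_le _ _ _) ?_
  have hb : ∀ j ∈ s.support, (Polynomial.aeval (MvPolynomial.X j : MvPolynomial σ A)
      ((Polynomial.X ^ s j : Polynomial A) %ₘ f j)).degreeOf i ≤
      if i = j then (f i).natDegree - 1 else 0 := by
    intro j _
    refine (degreeOf_aeval_le i j _).trans ?_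
    split_ifs with h
    · subst h
      have := Polynomial.natDegree_modByMonic_lt (Polynomial.X ^ s i : Polynomial A) (hf i).1
        (fun h1 => by simpa [h1] using (hf i).2)
      omega
    · exact Nat.le_refl 0
  refine lt_of_le_of_lt (Finset.sum_le_sum hb) ?_
  rw [Finset.sum_ite_eq]
  have := (hf i).2
  split_ifs <;> omega

theorem mk_reduce (q : MvPolynomial σ A) :
    Ideal.Quotient.mk (relIdeal f) (reduce f q) = Ideal.Quotient.mk (relIdeal f) q := by
  conv_rhs => rw [q.as_sum]
  conv_lhs => rw [q.as_sum]
  rw [map_sum, map_sum, map_sum]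
  refine Finset.sum_congr rfl fun s _ => ?_
  rw [reduce_monomial, MvPolynomial.monomial_eq, MvPolynomial.smul_eq_C_mul, map_mul, map_mul]
  congr 1
  rw [Finsupp.prod, Finsupp.prod, map_prod, map_prod]
  refine Finset.prod_congr rfl fun i _ => ?_
  conv_rhs => rw [← Polynomial.aeval_X_pow (R := A) (x := (MvPolynomial.X i : MvPolynomial σ A)),
    ← Polynomial.modByMonic_add_div (Polynomial.X ^ s i : Polynomial A) (f i)]
  rw [map_add, map_add, map_mul, map_mul]
  have : Ideal.Quotient.mk (relIdeal f) (Polynomial.aeval (MvPolynomial.X i) (f i)) = 0 :=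
    Ideal.Quotient.eq_zero_iff_mem.2 (Ideal.subset_span ⟨i, rfl⟩)
  rw [this, zero_mul, add_zero]

theorem reduce_monomial_mul_aeval (s : σ →₀ ℕ) (a : A) (i : σ) (p : Polynomial A)
    (hf : ∀ i, (f i).Monic ∧ 0 < (f i).natDegree) :
    reduce f (MvPolynomial.monomial s a * Polynomial.aeval (MvPolynomial.X i) p) =
      a • (Polynomial.aeval (MvPolynomial.X i) ((Polynomial.X ^ s i * p) %ₘ f i) *
        (s.erase i).prod fun j k =>
          (Polynomial.aeval (MvPolynomial.X j) (Polynomial.X ^ k %ₘ f j) : MvPolynomial σ A)) := by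
  have h1 : ∀ j : σ, (Polynomial.aeval (MvPolynomial.X j)
      ((Polynomial.X ^ 0 : Polynomial A) %ₘ f j) : MvPolynomial σ A) = 1 := by
    intro j
    rw [X_pow_modByMonic (hf j).1 (hf j).2]
    simp
  induction p using Polynomial.induction_on' with
  | add p q hp hq =>
    rw [map_add, mul_add, map_add, hp, hq, mul_add, Polynomial.add_modByMonic, map_add, add_mul,
      smul_add]
  | monomial k b =>
    have h2 : MvPolynomial.monomial s a * Polynomial.aeval (MvPolynomial.X i)
        (Polynomial.monomial k b) = MvPolynomial.monomial (s + Finsupp.single i k) (a * b) := by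
      rw [Polynomial.aeval_monomial, MvPolynomial.algebraMap_eq, MvPolynomial.C_apply,
        MvPolynomial.X_pow_eq_monomial, MvPolynomial.monomial_mul, MvPolynomial.monomial_mul,
        mul_one, zero_add]
    rw [h2, reduce_monomial, ← Finsupp.mul_prod_erase' _ i _ h1]
    have h3 : (s + Finsupp.single i k).erase i = s.erase i := by
      rw [Finsupp.erase_add, Finsupp.erase_single, add_zero]
    rw [h3, ← Polynomial.C_mul_X_pow_eq_monomial]
    have h4 : (Polynomial.X ^ s i * (Polynomial.C b * Polynomial.X ^ k) : Polynomial A) =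
        b • Polynomial.X ^ (s i + k) := by
      rw [Polynomial.smul_eq_C_mul, pow_add]
      ring
    rw [h4, Polynomial.smul_modByMonic, map_smul, smul_mul_assoc, smul_smul]
    simp

theorem reduce_eq_zero (hf : ∀ i, (f i).Monic ∧ 0 < (f i).natDegree) {q : MvPolynomial σ A}
    (hq : q ∈ relIdeal f) : reduce f q = 0 := by
  have key : ∀ p : MvPolynomial σ A, reduce f (p * q) = 0 := by
    refine Submodule.span_induction
      (p := fun x _ => ∀ p : MvPolynomial σ A, reduce f (p * x) = 0) ?_ ?_ ?_ ?_ hq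
    · rintro _ ⟨i, rfl⟩ p
      induction p using MvPolynomial.induction_on' with
      | monomial s a =>
        rw [reduce_monomial_mul_aeval s a i (f i) hf,
          (Polynomial.modByMonic_eq_zero_iff_dvd (hf i).1).2 (Dvd.intro_left _ rfl), map_zero,
          zero_mul, smul_zero]
      | add p q hp hq => rw [add_mul, map_add, hp, hq, add_zero]
    · intro p
      rw [mul_zero, map_zero]
    · intro x y _ _ hx hy p
      rw [mul_add, map_add, hx, hy, add_zero]
    · intro c x _ hx p
      rw [smul_eq_mul, ← mul_assoc]
      exact hx _
  simpa using key 1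

/-- Every class modulo the relations has exactly one minimal representative. -/
theorem existsUnique_isMinimal (hf : ∀ i, (f i).Monic ∧ 0 < (f i).natDegree)
    (z : MvPolynomial σ A ⧸ relIdeal f) :
    ∃! q, IsMinimal f q ∧ Ideal.Quotient.mk (relIdeal f) q = z := by
  obtain ⟨q, rfl⟩ := Ideal.Quotient.mk_surjective z
  refine ⟨reduce f q, ⟨isMinimal_reduce hf q, mk_reduce q⟩, ?_⟩
  rintro p ⟨hp, hpq⟩
  rw [Ideal.Quotient.eq] at hpq
  have := reduce_eq_zero hf hpq
  rw [map_sub, reduce_of_isMinimal hf hp] at this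
  exact sub_eq_zero.1 this

end Minimal

section ReduceNorm

variable {A : Type u} [NormedCommRing A] {σ : Type v} {f : σ → Polynomial A} {t : σ → ℝ}

theorem weightedNorm_reduce_monomial_le (hf : ∀ i, (f i).Monic ∧ 0 < (f i).natDegree)
    (ht : ∀ i, 0 < t i ∧
      ∑ k ∈ Finset.range (f i).natDegree, ‖(f i).coeff k‖ * t i ^ k ≤ t i ^ (f i).natDegree)
    (n : ℕ) : ∀ (s : σ →₀ ℕ) (a : A), s.degree = n →
      weightedNorm t (reduce f (MvPolynomial.monomial s a)) ≤ ‖a‖ * s.prod fun i k => t i ^ k := by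
  classical
  have ht0 : ∀ i, 0 < t i := fun i => (ht i).1
  induction n using Nat.strong_induction_on with
  | _ n ih =>
    intro s a hs
    by_cases hmin : ∀ i, s i < (f i).natDegree
    · rw [reduce_of_isMinimal hf, weightedNorm_monomial]
      intro i
      rw [MvPolynomial.degreeOf_lt_iff (hf i).2]
      intro m hm
      rw [Finset.mem_singleton.1 (MvPolynomial.support_monomial_subset hm)]
      exact hmin i
    · push Not at hmin
      obtain ⟨i, hi⟩ := hmin
      obtain ⟨s', rfl⟩ : ∃ s', s = s' + Finsupp.single i (f i).natDegree := by
        refine ⟨s - Finsupp.single i (f i).natDegree, ?_⟩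
        rw [tsub_add_cancel_of_le]
        exact Finsupp.single_le_iff.2 hi
      have hprod : ∀ k, ((s' + Finsupp.single i k).prod fun i k => t i ^ k) =
          (s'.prod fun i k => t i ^ k) * t i ^ k := by
        intro k
        rw [Finsupp.prod_add_index' (by simp) (by intros; rw [pow_add])]
        simp
      have hrel : MvPolynomial.monomial s' a * Polynomial.aeval (MvPolynomial.X i) (f i) ∈
          relIdeal f := Ideal.mul_mem_left _ _ (Ideal.subset_span ⟨i, rfl⟩)
      have hexp : MvPolynomial.monomial s' a * Polynomial.aeval (MvPolynomial.X i) (f i) =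
          ∑ k ∈ Finset.range ((f i).natDegree + 1),
            MvPolynomial.monomial (s' + Finsupp.single i k) (a * (f i).coeff k) := by
        rw [Polynomial.aeval_eq_sum_range, Finset.mul_sum]
        refine Finset.sum_congr rfl fun k _ => ?_
        rw [MvPolynomial.X_pow_eq_monomial, MvPolynomial.smul_monomial,
          MvPolynomial.monomial_mul, smul_eq_mul, mul_one]
      have h0 := reduce_eq_zero hf hrel
      rw [hexp, Finset.sum_range_succ, map_add, (hf i).1.coeff_natDegree, mul_one,
        add_eq_zero_iff_neg_eq', map_sum] at h0
      rw [← weightedNorm_neg, h0, hprod]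
      refine (weightedNorm_sum_le ht0 _ _).trans ?_
      have hw := (monomialWeight_nonneg ht0 s').le
      calc ∑ k ∈ Finset.range (f i).natDegree, weightedNorm t
            (reduce f (MvPolynomial.monomial (s' + Finsupp.single i k) (a * (f i).coeff k)))
          ≤ ∑ k ∈ Finset.range (f i).natDegree,
            (‖a‖ * s'.prod fun i k => t i ^ k) * (‖(f i).coeff k‖ * t i ^ k) := by
            refine Finset.sum_le_sum fun k hk => ?_
            refine (ih (s' + Finsupp.single i k).degree ?_ _ _ rfl).trans ?_
            · rw [← hs, map_add, map_add, Finsupp.degree_single, Finsupp.degree_single]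
              have := Finset.mem_range.1 hk
              omega
            · rw [hprod]
              calc ‖a * (f i).coeff k‖ * ((s'.prod fun i k => t i ^ k) * t i ^ k)
                  ≤ (‖a‖ * ‖(f i).coeff k‖) * ((s'.prod fun i k => t i ^ k) * t i ^ k) :=
                    mul_le_mul_of_nonneg_right (norm_mul_le _ _)
                      (mul_nonneg hw (pow_pos (ht0 i) _).le)
                _ = _ := by ring
        _ ≤ (‖a‖ * s'.prod fun i k => t i ^ k) * t i ^ (f i).natDegree := by
            rw [← Finset.mul_sum]
            exact mul_le_mul_of_nonneg_left (ht i).2 (mul_nonneg (norm_nonneg _) hw)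
        _ = _ := by ring

theorem weightedNorm_reduce_le (hf : ∀ i, (f i).Monic ∧ 0 < (f i).natDegree)
    (ht : ∀ i, 0 < t i ∧
      ∑ k ∈ Finset.range (f i).natDegree, ‖(f i).coeff k‖ * t i ^ k ≤ t i ^ (f i).natDegree)
    (q : MvPolynomial σ A) : weightedNorm t (reduce f q) ≤ weightedNorm t q := by
  conv_lhs => rw [q.as_sum]
  rw [map_sum]
  refine (weightedNorm_sum_le (fun i => (ht i).1) _ _).trans ?_
  exact Finset.sum_le_sum fun s _ => weightedNorm_reduce_monomial_le hf ht _ s _ rfl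

end ReduceNorm


section Narmania

variable {A : Type u} [NormedCommRing A]

/-- `U` is a set of monic polynomials of positive degree. -/
def IsMonicSet (U : Set (Polynomial A)) : Prop :=
  ∀ α ∈ U, α.Monic ∧ 0 < α.natDegree

/-- `t` is an admissible choice of Arens-Hoffman norm parameters for the polynomials in `U`:
`t_α > 0` and `t_α ^ n ≥ ∑_{k < n} ‖a_k‖ t_α ^ k` for `α = a_0 + ⋯ + a_{n-1} x^{n-1} + x^n`. -/
def IsNormParameter (U : Set (Polynomial A)) (t : U → ℝ) : Prop :=
  ∀ α : U, 0 < t α ∧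
    ∑ k ∈ Finset.range α.1.natDegree, ‖α.1.coeff k‖ * t α ^ k ≤ t α ^ α.1.natDegree

/-- The family of polynomials in a finite subset `S` of `U`. -/
def finFamily {U : Set (Polynomial A)} (S : Finset U) (α : S) : Polynomial A := α.1.1

/-- `A_S = A[x_α : α ∈ S] / (α(x_α) : α ∈ S)` for a finite subset `S` of `U`. -/
abbrev FinExt {U : Set (Polynomial A)} (S : Finset U) : Type u :=
  MvPolynomial S A ⧸ relIdeal (finFamily S)

variable {U : Set (Polynomial A)}

theorem IsMonicSet.finFamily (hU : IsMonicSet U) (S : Finset U) (α : S) :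
    (finFamily S α).Monic ∧ 0 < (AlgExt.finFamily S α).natDegree :=
  hU _ α.1.2

/-- The minimal representative of an element of `A_S`. -/
def FinExt.minimalRep (hU : IsMonicSet U) {S : Finset U} (z : FinExt S) : MvPolynomial S A :=
  (existsUnique_isMinimal (hU.finFamily S) z).choose

/-- The norm of `A_S`: if `q = ∑ s, q_s x^s` is the minimal representative of `z`, then
`‖z‖ = ∑ s, ‖q_s‖ t^s`. -/
def FinExt.norm (hU : IsMonicSet U) (t : U → ℝ) {S : Finset U} (z : FinExt S) : ℝ :=
  weightedNorm (fun α : S => t α) (FinExt.minimalRep hU z)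

/-- The natural map `A_S → A_T` for `S ⊆ T`, which sends the class of `x_α` to that of `x_α`. -/
def FinExt.transition {S T : Finset U} (h : S ≤ T) : FinExt S →ₐ[A] FinExt T :=
  Ideal.Quotient.liftₐ (relIdeal (finFamily S))
    ((Ideal.Quotient.mkₐ A (relIdeal (finFamily T))).comp
      (MvPolynomial.rename fun α : S => (⟨α.1, h α.2⟩ : T)))
    (by
      intro q hq
      have hle : relIdeal (finFamily S) ≤ RingHom.ker
          ((Ideal.Quotient.mkₐ A (relIdeal (finFamily T))).comp
            (MvPolynomial.rename fun α : S => (⟨α.1, h α.2⟩ : T))) := by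
        refine Ideal.span_le.2 ?_
        rintro _ ⟨α, rfl⟩
        refine (RingHom.mem_ker).2 ?_
        rw [AlgHom.comp_apply, ← Polynomial.aeval_algHom_apply, MvPolynomial.rename_X]
        exact Ideal.Quotient.eq_zero_iff_mem.2 (Ideal.subset_span ⟨⟨α.1, h α.2⟩, rfl⟩)
      exact hle hq)

theorem FinExt.transition_mk {S T : Finset U} (h : S ≤ T) (q : MvPolynomial S A) :
    FinExt.transition h (Ideal.Quotient.mk _ q) =
      Ideal.Quotient.mk (relIdeal (finFamily T))
        (MvPolynomial.rename (fun α : S => (⟨α.1, h α.2⟩ : T)) q) := rfl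

instance FinExt.directedSystem :
    DirectedSystem (fun S : Finset U => FinExt S) fun _ _ h => FinExt.transition h where
  map_self S z := by
    obtain ⟨q, rfl⟩ := Ideal.Quotient.mk_surjective z
    rw [FinExt.transition_mk]
    exact congrArg _ (MvPolynomial.rename_id_apply q)
  map_map S T W h h' z := by
    obtain ⟨q, rfl⟩ := Ideal.Quotient.mk_surjective z
    rw [FinExt.transition_mk, FinExt.transition_mk, FinExt.transition_mk,
      MvPolynomial.rename_rename]
    rfl

theorem FinExt.minimalRep_spec (hU : IsMonicSet U) {S : Finset U} (z : FinExt S) :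
    IsMinimal (finFamily S) (FinExt.minimalRep hU z) ∧
      Ideal.Quotient.mk (relIdeal (finFamily S)) (FinExt.minimalRep hU z) = z :=
  (existsUnique_isMinimal (hU.finFamily S) z).choose_spec.1

theorem FinExt.minimalRep_mk (hU : IsMonicSet U) {S : Finset U} (q : MvPolynomial S A) :
    FinExt.minimalRep hU (Ideal.Quotient.mk (relIdeal (finFamily S)) q : FinExt S) =
      reduce (finFamily S) q :=
  (existsUnique_isMinimal (hU.finFamily S) _).unique (FinExt.minimalRep_spec hU _)
    ⟨isMinimal_reduce (hU.finFamily S) q, mk_reduce q⟩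

theorem FinExt.minimalRep_unique (hU : IsMonicSet U) {S : Finset U} {z : FinExt S}
    {q : MvPolynomial S A} (hq : IsMinimal (finFamily S) q)
    (hz : Ideal.Quotient.mk (relIdeal (finFamily S)) q = z) : FinExt.minimalRep hU z = q :=
  (existsUnique_isMinimal (hU.finFamily S) _).unique (FinExt.minimalRep_spec hU _) ⟨hq, hz⟩

theorem FinExt.norm_transition (hU : IsMonicSet U) (t : U → ℝ) {S T : Finset U} (h : S ≤ T)
    (z : FinExt S) : FinExt.norm hU t z = FinExt.norm hU t (FinExt.transition h z) := by
  have hinj : Function.Injective fun α : S => (⟨α.1, h α.2⟩ : T) := fun a b hab =>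
    Subtype.ext (congrArg (fun x : T => x.1) hab)
  have hz := FinExt.minimalRep_spec hU z
  have : FinExt.minimalRep hU (FinExt.transition h z) =
      MvPolynomial.rename (fun α : S => (⟨α.1, h α.2⟩ : T)) (FinExt.minimalRep hU z) := by
    refine FinExt.minimalRep_unique hU ?_ ?_
    · intro β
      by_cases hβ : ∃ α : S, (⟨α.1, h α.2⟩ : T) = β
      · obtain ⟨α, rfl⟩ := hβ
        rw [MvPolynomial.degreeOf_rename_of_injective hinj]
        exact hz.1 α
      · classical
        rw [MvPolynomial.degreeOf_lt_iff (hU.finFamily T β).2]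
        intro m hm
        rw [MvPolynomial.support_rename_of_injective hinj, Finset.mem_image] at hm
        obtain ⟨m', _, rfl⟩ := hm
        rw [Finsupp.mapDomain_of_notMem_range _ _ hβ]
        exact (hU.finFamily T β).2
    · rw [← FinExt.transition_mk h, hz.2]
  rw [FinExt.norm, FinExt.norm, this, weightedNorm_rename hinj]
  rfl

/-- The direct limit `D` of the algebras `A_S`, `S` a finite subset of `U`; it is normed by the
instance below, for which `hU` and `ht` are needed. -/
def LimitExt (_hU : IsMonicSet U) {t : U → ℝ} (_ht : IsNormParameter U t) : Type u :=
  DirectLimit (fun S : Finset U => FinExt S) fun _ _ h => FinExt.transition h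

variable (hU : IsMonicSet U) {t : U → ℝ} (ht : IsNormParameter U t)

namespace LimitExt

instance : CommRing (LimitExt hU ht) :=
  inferInstanceAs (CommRing (DirectLimit (fun S : Finset U => FinExt S)
    fun _ _ h => FinExt.transition h))

/-- The class in `D` of an element of `A_S`. -/
def of (S : Finset U) : FinExt S →+* LimitExt hU ht where
  toFun z := (⟦⟨S, z⟩⟧ : DirectLimit (fun S : Finset U => FinExt S)
    fun _ _ h => FinExt.transition h)
  map_one' := (DirectLimit.one_def S).symm
  map_zero' := (DirectLimit.zero_def S).symm
  map_mul' x y := (DirectLimit.mul_def S x y).symm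
  map_add' x y := (DirectLimit.add_def S x y).symm

theorem of_transition {S T : Finset U} (h : S ≤ T) (z : FinExt S) :
    of hU ht T (FinExt.transition h z) = of hU ht S z :=
  DirectLimit.mk_apply (f := fun _ _ h => FinExt.transition h) S T z h

theorem exists_of (x : LimitExt hU ht) : ∃ S z, of hU ht S z = x :=
  let ⟨S, z, h⟩ := DirectLimit.exists_eq_mk (fun _ _ h => FinExt.transition h) x
  ⟨S, z, h.symm⟩

theorem exists_of₂ (x y : LimitExt hU ht) : ∃ S z w, of hU ht S z = x ∧ of hU ht S w = y :=
  let ⟨S, z, w, h, h'⟩ := DirectLimit.exists_eq_mk₂ (fun _ _ h => FinExt.transition h) x y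
  ⟨S, z, w, h.symm, h'.symm⟩

/-- The common value of the norms of the representatives in the algebras `A_S`. -/
def limitNorm : LimitExt hU ht → ℝ :=
  DirectLimit.lift (fun _ _ h => FinExt.transition h) (fun _ z => FinExt.norm hU t z)
    fun _ _ h z => FinExt.norm_transition hU t h z

theorem limitNorm_of {S : Finset U} (z : FinExt S) :
    limitNorm hU ht (of hU ht S z) = FinExt.norm hU t z := rfl

end LimitExt

theorem FinExt.norm_mk_le (hU : IsMonicSet U) {t : U → ℝ} (ht : IsNormParameter U t)
    {S : Finset U} (q : MvPolynomial S A) :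
    FinExt.norm hU t (Ideal.Quotient.mk (relIdeal (finFamily S)) q : FinExt S) ≤
      weightedNorm (fun α : S => t α) q := by
  rw [FinExt.norm, FinExt.minimalRep_mk]
  exact weightedNorm_reduce_le (hU.finFamily S) (fun α => ht α.1) q

theorem FinExt.norm_add_le (hU : IsMonicSet U) {t : U → ℝ} (ht : IsNormParameter U t)
    {S : Finset U} (z w : FinExt S) :
    FinExt.norm hU t (z + w) ≤ FinExt.norm hU t z + FinExt.norm hU t w := by
  have h : z + w = Ideal.Quotient.mk (relIdeal (finFamily S))
      (FinExt.minimalRep hU z + FinExt.minimalRep hU w) := by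
    rw [map_add, (FinExt.minimalRep_spec hU z).2, (FinExt.minimalRep_spec hU w).2]
  rw [h]
  exact (FinExt.norm_mk_le hU ht _).trans
    (weightedNorm_add_le (t := fun α : S => t α) (fun α => (ht α.1).1)
      (FinExt.minimalRep hU z) (FinExt.minimalRep hU w))

theorem FinExt.norm_mul_le (hU : IsMonicSet U) {t : U → ℝ} (ht : IsNormParameter U t)
    {S : Finset U} (z w : FinExt S) :
    FinExt.norm hU t (z * w) ≤ FinExt.norm hU t z * FinExt.norm hU t w := by
  have h : z * w = Ideal.Quotient.mk (relIdeal (finFamily S))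
      (FinExt.minimalRep hU z * FinExt.minimalRep hU w) := by
    rw [map_mul, (FinExt.minimalRep_spec hU z).2, (FinExt.minimalRep_spec hU w).2]
  rw [h]
  exact (FinExt.norm_mk_le hU ht _).trans
    (weightedNorm_mul_le (t := fun α : S => t α) (fun α => (ht α.1).1)
      (FinExt.minimalRep hU z) (FinExt.minimalRep hU w))

theorem FinExt.norm_zero (hU : IsMonicSet U) (t : U → ℝ) {S : Finset U} :
    FinExt.norm hU t (0 : FinExt S) = 0 := by
  have h : (0 : FinExt S) = Ideal.Quotient.mk (relIdeal (finFamily S)) 0 := (map_zero _).symm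
  rw [FinExt.norm, h, FinExt.minimalRep_mk, map_zero, weightedNorm_zero]

theorem FinExt.norm_neg (hU : IsMonicSet U) (t : U → ℝ) {S : Finset U} (z : FinExt S) :
    FinExt.norm hU t (-z) = FinExt.norm hU t z := by
  have h : -z = Ideal.Quotient.mk (relIdeal (finFamily S)) (-FinExt.minimalRep hU z) := by
    rw [map_neg, (FinExt.minimalRep_spec hU z).2]
  rw [FinExt.norm, h, FinExt.minimalRep_mk, map_neg,
    reduce_of_isMinimal (hU.finFamily S) (FinExt.minimalRep_spec hU z).1, weightedNorm_neg]
  rfl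

theorem FinExt.eq_zero_of_norm (hU : IsMonicSet U) {t : U → ℝ} (ht : IsNormParameter U t)
    {S : Finset U} {z : FinExt S} (h : FinExt.norm hU t z = 0) : z = 0 := by
  rw [← (FinExt.minimalRep_spec hU z).2,
    eq_zero_of_weightedNorm (fun α : S => (ht α.1).1) h, map_zero]

namespace LimitExt

instance : NormedCommRing (LimitExt hU ht) where
  __ := RingNorm.toNormedRing
    { toFun := limitNorm hU ht
      map_zero' := by
        rw [← map_zero (of hU ht ∅), limitNorm_of, FinExt.norm_zero]
      add_le' := fun x y => by
        obtain ⟨S, z, w, rfl, rfl⟩ := exists_of₂ hU ht x y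
        rw [← map_add, limitNorm_of, limitNorm_of, limitNorm_of]
        exact FinExt.norm_add_le hU ht z w
      neg' := fun x => by
        obtain ⟨S, z, rfl⟩ := exists_of hU ht x
        rw [← map_neg, limitNorm_of, limitNorm_of, FinExt.norm_neg]
      mul_le' := fun x y => by
        obtain ⟨S, z, w, rfl, rfl⟩ := exists_of₂ hU ht x y
        rw [← map_mul, limitNorm_of, limitNorm_of, limitNorm_of]
        exact FinExt.norm_mul_le hU ht z w
      eq_zero_of_map_eq_zero' := fun x hx => by
        obtain ⟨S, z, rfl⟩ := exists_of hU ht x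
        rw [limitNorm_of] at hx
        rw [FinExt.eq_zero_of_norm hU ht hx, map_zero] }
  mul_comm := mul_comm

theorem norm_of {S : Finset U} (z : FinExt S) : ‖of hU ht S z‖ = FinExt.norm hU t z := rfl

/-- The embedding of `A = A_∅` into `D`. -/
def inclusion : A →+* LimitExt hU ht :=
  (of hU ht ∅).comp (algebraMap A (FinExt (∅ : Finset U)))

/-- The class of `x_α` in `D`. -/
def root (α : U) : LimitExt hU ht :=
  of hU ht {α} (Ideal.Quotient.mk (relIdeal (finFamily {α}))
    (MvPolynomial.X ⟨α, Finset.mem_singleton_self α⟩))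

theorem of_algebraMap (S : Finset U) (a : A) :
    of hU ht S (algebraMap A (FinExt S) a) = inclusion hU ht a := by
  rw [← (FinExt.transition (Finset.empty_subset S)).commutes a]
  exact of_transition hU ht _ _

variable [NormedAlgebra ℂ A]

instance : Algebra ℂ (LimitExt hU ht) :=
  ((inclusion hU ht).comp (algebraMap ℂ A)).toAlgebra

theorem smul_of (c : ℂ) {S : Finset U} (q : MvPolynomial S A) :
    c • of hU ht S (Ideal.Quotient.mk (relIdeal (finFamily S)) q) =
      of hU ht S (Ideal.Quotient.mk (relIdeal (finFamily S)) (c • q)) := by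
  rw [Algebra.smul_def]
  change inclusion hU ht (algebraMap ℂ A c) * _ = _
  rw [← of_algebraMap hU ht S, ← map_mul, ← algebraMap_smul A c q, MvPolynomial.smul_eq_C_mul]
  exact congrArg (of hU ht S) (map_mul (Ideal.Quotient.mk (relIdeal (finFamily S))) _ _).symm

instance : NormedAlgebra ℂ (LimitExt hU ht) where
  norm_smul_le c x := by
    obtain ⟨S, z, rfl⟩ := exists_of hU ht x
    have h : c • of hU ht S z = of hU ht S
        (Ideal.Quotient.mk (relIdeal (finFamily S)) (c • FinExt.minimalRep hU z)) := by
      rw [← smul_of, (FinExt.minimalRep_spec hU z).2]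
    rw [h, norm_of, norm_of]
    exact (FinExt.norm_mk_le hU ht _).trans
      (weightedNorm_smul_le (t := fun α : S => t α) (fun α => (ht α.1).1) c
        (FinExt.minimalRep hU z))

end LimitExt

variable [NormedAlgebra ℂ A]

/-- The Narmania extension `A_U`: the completion of the direct limit of the algebras `A_S`. -/
abbrev NarmaniaExt : Type u := UniformSpace.Completion (LimitExt hU ht)

/-- The canonical map `A → A_U`. -/
def NarmaniaExt.inclusion (a : A) : NarmaniaExt hU ht :=
  (LimitExt.inclusion hU ht a : LimitExt hU ht)

/-- The class of `x_α` in `A_U`. -/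
def NarmaniaExt.root (α : U) : NarmaniaExt hU ht :=
  (LimitExt.root hU ht α : LimitExt hU ht)

end Narmania

section Standard

/-- The Arens-Hoffman norm with parameter `t` on `C[x]/(α)`: if `b_0 + ⋯ + b_{n-1} x^{n-1}` is the
representative of `z` of degree less than `n = deg α`, then `‖z‖ = ∑ k < n, ‖b_k‖ t ^ k`. -/
def arensHoffmanNorm {C : Type*} [NormedCommRing C] {α : Polynomial C} (hα : α.Monic) (t : ℝ)
    (z : AdjoinRoot α) : ℝ :=
  ∑ k ∈ Finset.range α.natDegree, ‖(AdjoinRoot.modByMonicHom hα z).coeff k‖ * t ^ k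

variable {A : Type u} [NormedCommRing A] {U : Set (Polynomial A)}

/-- The subalgebra `B_{<β}`: the union of the `B_α` with `α < β`, or the image of `A` if `β` is the
least element. (For an increasing family, the supremum is the union, and it is the image of `A`
if the family is empty.) -/
def below {B : Type*} [CommRing B] [Algebra A B] (r : U → U → Prop) (sub : U → Subalgebra A B)
    (β : U) : Subalgebra A B :=
  ⨆ (α : U) (_ : r α β), sub α

/-- The data that make the normed `A`-algebra `B` a standard extension `B_U` of `A`, for the strict
well-ordering `r` of `U` and the norm parameters `t`. -/
structure StandardExtension (hU : IsMonicSet U) (t : U → ℝ) (r : U → U → Prop)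
    (B : Type*) [NormedCommRing B] [Algebra A B] where
  /-- The embedding of `A` is isometric. -/
  norm_algebraMap : ∀ a : A, ‖algebraMap A B a‖ = ‖a‖
  /-- The subalgebras `B_α`. -/
  sub : U → Subalgebra A B
  /-- They form an increasing family. -/
  mono : ∀ α β, r α β → sub α ≤ sub β
  /-- The isomorphism `ψ_β` of the Arens-Hoffman extension of `B_{<β}` by `β(x)` with `B_β`; it
  fixes the elements of `B_{<β}`. -/
  psi : ∀ β : U,
    AdjoinRoot (β.1.map (algebraMap A (below r sub β))) →ₐ[below r sub β] B
  /-- `ψ_β` maps onto `B_β`. -/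
  range_psi : ∀ β : U, Set.range (psi β) = sub β
  /-- `ψ_β` is isometric. -/
  norm_psi : ∀ (β : U) (z : AdjoinRoot (β.1.map (algebraMap A (below r sub β)))),
    ‖psi β z‖ = arensHoffmanNorm ((hU β.1 β.2).1.map (algebraMap A (below r sub β))) (t β) z
  /-- The subalgebras `B_α` exhaust `B`. (If `U` is empty, this says that `B = A`.) -/
  iSup_sub : ⨆ α, sub α = ⊤

/-- The standard root `ψ_β(x̄)` of `β` in `B_U`. -/
def StandardExtension.root {hU : IsMonicSet U} {t : U → ℝ} {r : U → U → Prop}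
    {B : Type*} [NormedCommRing B] [Algebra A B] (E : StandardExtension hU t r B) (β : U) : B :=
  E.psi β (AdjoinRoot.root _)

end Standard

section Cole

/-- `A` is a uniform algebra on `X`: a closed subalgebra of `C(X)` that contains the constants and
separates the points of `X`. -/
def IsUniformAlgebra {X : Type*} [TopologicalSpace X] [CompactSpace X]
    (A : Subalgebra ℂ C(X, ℂ)) : Prop :=
  IsClosed (A : Set C(X, ℂ)) ∧ A.SeparatesPoints

variable {X : Type u} [TopologicalSpace X] [CompactSpace X] {A : Subalgebra ℂ C(X, ℂ)}
  {U : Set (Polynomial A)}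

/-- The space `X^U` of all `(κ, λ) ∈ X × ℂ^U` such that
`f_0(κ) + ⋯ + f_{n-1}(κ) λ_α^{n-1} + λ_α^n = 0` for all `α = f_0 + ⋯ + f_{n-1} x^{n-1} + x^n`
in `U`. -/
def ColeSpace (_hU : IsMonicSet U) : Type u :=
  {p : X × (U → ℂ) // ∀ α : U,
    ∑ k ∈ Finset.range (α.1.natDegree + 1), (α.1.coeff k : C(X, ℂ)) p.1 * p.2 α ^ k = 0}

variable (hU : IsMonicSet U)

instance : TopologicalSpace (ColeSpace hU) := instTopologicalSpaceSubtype

theorem norm_le_of_monic_root (n : ℕ) (c : ℕ → ℂ) (R : ℝ) (z : ℂ)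
    (hR : 1 + ∑ k ∈ Finset.range n, ‖c k‖ ≤ R)
    (hz : ∑ k ∈ Finset.range n, c k * z ^ k + z ^ n = 0) : ‖z‖ ≤ R := by
  by_contra! h
  have hs : 0 ≤ ∑ k ∈ Finset.range n, ‖c k‖ := Finset.sum_nonneg fun _ _ => norm_nonneg _
  have h1 : 1 < ‖z‖ := by linarith
  rcases Nat.eq_zero_or_pos n with rfl | hn
  · simp at hz
  obtain ⟨m, rfl⟩ : ∃ m, n = m + 1 := ⟨n - 1, by omega⟩
  have h2 : ‖z‖ ^ (m + 1) ≤ (∑ k ∈ Finset.range (m + 1), ‖c k‖) * ‖z‖ ^ m := by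
    rw [← norm_pow, eq_neg_of_add_eq_zero_right hz, norm_neg, Finset.sum_mul]
    refine (norm_sum_le _ _).trans (Finset.sum_le_sum fun k hk => ?_)
    rw [norm_mul, norm_pow]
    exact mul_le_mul_of_nonneg_left (pow_le_pow_right₀ h1.le
      (Nat.lt_succ_iff.1 (Finset.mem_range.1 hk))) (norm_nonneg _)
  rw [pow_succ'] at h2
  have := le_of_mul_le_mul_right h2 (pow_pos (by linarith) m)
  linarith

instance : CompactSpace (ColeSpace hU) := by
  refine isCompact_iff_compactSpace.1 ?_
  let R : U → ℝ := fun α => 1 + ∑ k ∈ Finset.range α.1.natDegree, ‖(α.1.coeff k : C(X, ℂ))‖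
  have hK : IsCompact ((Set.univ : Set X) ×ˢ
      (Set.univ.pi fun α : U => Metric.closedBall (0 : ℂ) (R α))) :=
    isCompact_univ.prod (isCompact_univ_pi fun α => isCompact_closedBall _ _)
  refine hK.of_isClosed_subset ?_ ?_
  · have hset : {p : X × (U → ℂ) | ∀ α : U, ∑ k ∈ Finset.range (α.1.natDegree + 1),
        (α.1.coeff k : C(X, ℂ)) p.1 * p.2 α ^ k = 0} = ⋂ α : U, {p : X × (U → ℂ) |
        ∑ k ∈ Finset.range (α.1.natDegree + 1),
          (α.1.coeff k : C(X, ℂ)) p.1 * p.2 α ^ k = 0} := by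
      ext p
      simp
    change IsClosed {p : X × (U → ℂ) | ∀ α : U, ∑ k ∈ Finset.range (α.1.natDegree + 1),
        (α.1.coeff k : C(X, ℂ)) p.1 * p.2 α ^ k = 0}
    rw [hset]
    refine isClosed_iInter fun α => isClosed_eq ?_ continuous_const
    fun_prop
  · rintro ⟨x, l⟩ hp
    refine ⟨Set.mem_univ _, fun α _ => ?_⟩
    rw [mem_closedBall_zero_iff]
    have hm := (hU α.1 α.2).1
    have := hp α
    rw [Finset.sum_range_succ, hm.coeff_natDegree] at this
    refine norm_le_of_monic_root α.1.natDegree (fun k => (α.1.coeff k : C(X, ℂ)) x) (R α) (l α) ?_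
      (by simpa using this)
    exact add_le_add_right (Finset.sum_le_sum fun k _ => ContinuousMap.norm_coe_le_norm _ _) 1

/-- The projection `π : X^U → X`. -/
def ColeSpace.proj : C(ColeSpace hU, X) where
  toFun p := p.1.1
  continuous_toFun := continuous_fst.comp continuous_subtype_val

/-- The coordinate function `p_α : (κ, λ) ↦ λ_α` on `X^U`. -/
def ColeSpace.coord (α : U) : C(ColeSpace hU, ℂ) where
  toFun p := p.1.2 α
  continuous_toFun := (continuous_apply α).comp (continuous_snd.comp continuous_subtype_val)

/-- The Cole extension `A^U`: the closed subalgebra of `C(X^U)` generated by the functions `f ∘ π`,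
`f ∈ A`, and the functions `p_α`, `α ∈ U`. -/
def coleExt : Subalgebra ℂ C(ColeSpace hU, ℂ) :=
  (Algebra.adjoin ℂ (Set.range (fun f : A => (f : C(X, ℂ)).comp (ColeSpace.proj hU)) ∪
    Set.range (ColeSpace.coord hU))).topologicalClosure

theorem comp_proj_mem (f : A) : (f : C(X, ℂ)).comp (ColeSpace.proj hU) ∈ coleExt hU :=
  Subalgebra.le_topologicalClosure _ (Algebra.subset_adjoin (Or.inl ⟨f, rfl⟩))

theorem coord_mem (α : U) : ColeSpace.coord hU α ∈ coleExt hU :=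
  Subalgebra.le_topologicalClosure _ (Algebra.subset_adjoin (Or.inr ⟨α, rfl⟩))

/-- The element `π^*(f)` of `A^U`. -/
def coleExt.inclusion (f : A) : coleExt hU := ⟨_, comp_proj_mem hU f⟩

/-- The element `p_α` of `A^U`. -/
def coleExt.root (α : U) : coleExt hU := ⟨_, coord_mem hU α⟩

end Cole

section Gelfand

open WeakDual

/-- The space of continuous characters of a (possibly incomplete) normed algebra is compact. -/
instance compactSpace_characterSpace (B : Type*) [NormedCommRing B] [NormedAlgebra ℂ B] :
    CompactSpace (characterSpace ℂ B) := by
  have hb : ∀ (φ : characterSpace ℂ B) (b : B), ‖φ b‖ ≤ ‖b‖ := by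
    intro φ b
    obtain ⟨C, hC0, hC⟩ := (toStrongDual (φ : WeakDual ℂ B)).isBoundedLinearMap.bound
    have hC' : ∀ x : B, ‖φ x‖ ≤ C * ‖x‖ := hC
    by_contra! h
    have hpow : ∀ n : ℕ, 0 < n → ‖φ b‖ ^ n ≤ C * ‖b‖ ^ n := by
      intro n hn
      rw [← norm_pow, ← map_pow]
      exact (hC' _).trans (mul_le_mul_of_nonneg_left (norm_pow_le' b hn) hC0.le)
    rcases (norm_nonneg b).eq_or_lt with h0 | h0
    · have := hpow 1 one_pos
      rw [← h0] at this h
      simp only [pow_one, mul_zero] at this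
      linarith
    · have h1 : 1 < ‖φ b‖ / ‖b‖ := (one_lt_div h0).2 h
      obtain ⟨n, hn⟩ := pow_unbounded_of_one_lt C h1
      have h2 := hpow (n + 1) n.succ_pos
      rw [← div_le_iff₀ (pow_pos h0 _), ← div_pow] at h2
      have h3 := pow_le_pow_right₀ h1.le n.le_succ
      exact absurd (hn.trans_le (h3.trans h2)) (lt_irrefl _)
  rw [← isCompact_iff_compactSpace]
  have h : characterSpace ℂ B ⊆ toStrongDual ⁻¹' Metric.closedBall 0 1 := by
    intro φ hφ
    rw [Set.mem_preimage, mem_closedBall_zero_iff]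
    refine ContinuousLinearMap.opNorm_le_bound _ zero_le_one fun b => ?_
    rw [one_mul]
    exact hb ⟨φ, hφ⟩ b
  exact (WeakDual.isCompact_closedBall 0 1).of_isClosed_subset CharacterSpace.isClosed h

/-- The closure, with respect to the supremum norm, of the algebra of Gelfand transforms of the
elements of the normed algebra `B`. -/
def gelfandClosure (B : Type*) [NormedCommRing B] [NormedAlgebra ℂ B] :
    Subalgebra ℂ C(characterSpace ℂ B, ℂ) :=
  (gelfandTransform ℂ B).range.topologicalClosure

/-- The Gelfand transform of `b`, as an element of the closure. -/
def gelfandClosure.of {B : Type*} [NormedCommRing B] [NormedAlgebra ℂ B] (b : B) :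
    gelfandClosure B :=
  ⟨gelfandTransform ℂ B b, Subalgebra.le_topologicalClosure _ ⟨b, rfl⟩⟩

end Gelfand

end AlgExt

end

/-! All the algebras in question carry one and the same seminorm. Let `P = A[x_α : α ∈ U]` and let
`reduce q` be the minimal representative of `q ∈ P` modulo the relations `α(x_α)`. Then `P` maps
onto the direct limit of the `A_S` and onto every standard extension, with `x_α` going to the chosen
root, and in each case the norm of the image of `q` is `weightedNorm t (reduce q)`
(`LimitExt.norm_ofPoly`, `StandardExtension.norm_aeval`). For a standard extension the reason is
that the Arens–Hoffman norm in the `r`-largest indeterminate of a minimal polynomial, applied to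
coefficients that involve earlier indeterminates only, splits exactly as the weighted norm does. The
same splitting turns the direct limit, filtered along `r`, into a standard extension. Complete
algebras with dense images of `P` and equal seminorms are isometrically isomorphic
(`exists_isometric_algEquiv`), which gives (1).

For (2) the supremum norm of `q` on the Cole space has to equal that of its Gelfand transform.
Points of the Cole space are characters, because their coordinates satisfy `|λ_α| ≤ t_α`
(`IsRootSpace.norm_coord_le`). The converse inequality is the heart of the matter: a character of
the extension lies over a character of `A` that need not be a point of `X`, so it need not come from
the Cole space. But `q` lives in some `A_S`, which is finite and free over `A`. The coefficients of
the characteristic polynomial of multiplication by `q ^ m` belong to `A`, and at a point of `X` its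
roots are values of `q ^ m` at points of the Cole space. This bounds the coefficients on `X`, hence
in the norm of `A`, hence at every character of `A`. By Cayley–Hamilton the value of `q ^ m` at the
given character is a root of the specialized polynomial, and `m → ∞` removes the constant that is
lost (`norm_apply_le_of_norming`). -/

noncomputable section

namespace AlgExt

/-! ### Extension of homomorphisms by density -/

section Extension

variable {D C₁ C₂ : Type*} [CommRing D] [Algebra ℂ D] [NormedCommRing C₁] [NormedAlgebra ℂ C₁]
  [NormedCommRing C₂] [NormedAlgebra ℂ C₂]

/-- A homomorphism that is dominated by a homomorphism with dense range factors through it. -/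
theorem exists_algHom_extension [CompleteSpace C₂] (g₁ : D →ₐ[ℂ] C₁) (g₂ : D →ₐ[ℂ] C₂)
    (hd : DenseRange g₁) (h : ∀ d, ‖g₂ d‖ ≤ ‖g₁ d‖) :
    ∃ Φ : C₁ →ₐ[ℂ] C₂, (∀ x, ‖Φ x‖ ≤ ‖x‖) ∧ ∀ d, Φ (g₁ d) = g₂ d := by
  -- The algebra `D` has no norm of its own. With the seminorm pulled back along `g₁`, the map `g₁`
  -- is uniformly inducing and `h` says that `g₂` is contractive.
  let _ : SeminormedRing D := SeminormedRing.induced D C₁ g₁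
  have hn : ∀ d : D, ‖d‖ = ‖g₁ d‖ := fun _ => rfl
  have hu : IsUniformInducing (g₁ : D →+* C₁) := ⟨rfl⟩
  have hf : UniformContinuous (g₂ : D →+* C₂) :=
    AddMonoidHomClass.uniformContinuous_of_bound (g₂ : D →+* C₂) 1 fun d => by
      rw [one_mul, hn]
      exact h d
  have hd' : DenseRange (g₁ : D →+* C₁) := hd
  let F : C₁ →+* C₂ := IsDenseInducing.extendRingHom hu hd' hf
  have hF : ∀ d, F (g₁ d) = g₂ d := fun d =>
    (hu.isDenseInducing hd').extend_eq hf.continuous d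
  have hFc : Continuous F :=
    (uniformContinuous_uniformly_extend hu hd' hf).continuous
  refine ⟨{ F with commutes' := fun c => ?_ }, fun x => ?_, hF⟩
  · change F _ = _
    rw [← AlgHom.commutes g₁, hF, AlgHom.commutes]
  · change ‖F x‖ ≤ ‖x‖
    refine hd.induction_on x (isClosed_le hFc.norm continuous_norm) fun d => ?_
    rw [hF]
    exact h d

/-- Two complete normed algebras with dense homomorphisms from one algebra that induce the same
seminorm are isometrically isomorphic. -/
theorem exists_isometric_algEquiv [CompleteSpace C₁] [CompleteSpace C₂] (g₁ : D →ₐ[ℂ] C₁)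
    (g₂ : D →ₐ[ℂ] C₂) (hd₁ : DenseRange g₁) (hd₂ : DenseRange g₂) (h : ∀ d, ‖g₁ d‖ = ‖g₂ d‖) :
    ∃ Φ : C₁ ≃ₐ[ℂ] C₂, Isometry Φ ∧ ∀ d, Φ (g₁ d) = g₂ d := by
  obtain ⟨Φ, hΦ, hΦg⟩ := exists_algHom_extension g₁ g₂ hd₁ fun d => (h d).ge
  obtain ⟨Ψ, hΨ, hΨg⟩ := exists_algHom_extension g₂ g₁ hd₂ fun d => (h d).le
  have hΦc : Continuous Φ := AddMonoidHomClass.continuous_of_bound Φ 1 (by simpa using hΦ)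
  have hΨc : Continuous Ψ := AddMonoidHomClass.continuous_of_bound Ψ 1 (by simpa using hΨ)
  have h₁ : ∀ x, Ψ (Φ x) = x := fun x =>
    hd₁.induction_on x (isClosed_eq (hΨc.comp hΦc) continuous_id) fun d => by
      rw [hΦg, hΨg]
  have h₂ : ∀ x, Φ (Ψ x) = x := fun x =>
    hd₂.induction_on x (isClosed_eq (hΦc.comp hΨc) continuous_id) fun d => by
      rw [hΨg, hΦg]
  refine ⟨AlgEquiv.ofAlgHom Φ Ψ (AlgHom.ext h₂) (AlgHom.ext h₁), ?_, hΦg⟩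
  refine AddMonoidHomClass.isometry_of_norm _ fun x => ?_
  refine le_antisymm (hΦ x) ?_
  conv_lhs => rw [← h₁ x]
  exact hΨ _

theorem denseRange_codRestrict (g : D →ₐ[ℂ] C₁) (K : Subalgebra ℂ C₁) (hg : ∀ d, g d ∈ K)
    (hK : (K : Set C₁) ⊆ closure (Set.range g)) : DenseRange (g.codRestrict K hg) := by
  intro x
  rw [closure_subtype]
  refine closure_mono ?_ (hK x.2)
  rintro _ ⟨d, rfl⟩
  exact ⟨g.codRestrict K hg d, ⟨d, rfl⟩, rfl⟩

end Extension

/-! ### Characteristic polynomials and bounds for roots -/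

section Charpoly

open TensorProduct

/-- A root of the characteristic polynomial of multiplication by `b`, specialized at a point `κ` of
the base, is the value of `b` at a point of the fibre over `κ`. -/
theorem exists_ringHom_of_isRoot_charpoly {R T : Type*} [CommRing R] [CommRing T] [Algebra R T]
    [Module.Free R T] [Module.Finite R T] (b : T) (κ : R →+* ℂ) (z : ℂ)
    (hz : ((Algebra.lmul R T b).charpoly.map κ).IsRoot z) :
    ∃ χ : T →+* ℂ, (∀ r, χ (algebraMap R T r) = κ r) ∧ χ b = z := by
  let _ : Algebra R ℂ := κ.toAlgebra
  have hκ : algebraMap R ℂ = κ := rfl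
  -- Base change along `κ` makes `z` an eigenvalue of multiplication by `1 ⊗ b` on the
  -- finite-dimensional complex algebra `ℂ ⊗ T`.
  rw [← hκ, ← LinearMap.charpoly_baseChange, Algebra.baseChange_lmul,
    ← Module.End.hasEigenvalue_iff_isRoot_charpoly] at hz
  obtain ⟨v, hv⟩ := hz.exists_hasEigenvector
  have hv1 := hv.apply_eq_smul
  -- The element `1 ⊗ b - z` annihilates the non-zero eigenvector `v`, so it is not invertible and
  -- lies in a maximal ideal; the residue field there is integral over `ℂ`, hence is `ℂ`.
  have hnu : ¬ IsUnit ((1 : ℂ) ⊗ₜ[R] b - algebraMap ℂ (ℂ ⊗[R] T) z) := by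
    intro hu
    refine hv.2 (hu.mul_right_eq_zero.1 ?_)
    rw [sub_mul, ← Algebra.smul_def, ← hv1]
    simp
  obtain ⟨m, hm, hbm⟩ := exists_max_ideal_of_mem_nonunits hnu
  let _ : Field ((ℂ ⊗[R] T) ⧸ m) := Ideal.Quotient.field m
  let e : ℂ ≃ₐ[ℂ] ((ℂ ⊗[R] T) ⧸ m) :=
    AlgEquiv.ofBijective (Algebra.ofId ℂ _) IsAlgClosed.algebraMap_bijective_of_isIntegral
  let q : ℂ ⊗[R] T →ₐ[ℂ] ℂ := (e.symm : _ →ₐ[ℂ] ℂ).comp (Ideal.Quotient.mkₐ ℂ m)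
  refine ⟨(q : ℂ ⊗[R] T →+* ℂ).comp (Algebra.TensorProduct.includeRight : T →ₐ[R] ℂ ⊗[R] T),
    fun r => ?_, ?_⟩
  · change q ((Algebra.TensorProduct.includeRight : T →ₐ[R] ℂ ⊗[R] T) (algebraMap R T r)) = _
    rw [AlgHom.commutes, IsScalarTower.algebraMap_apply R ℂ (ℂ ⊗[R] T), AlgHom.commutes]
    rfl
  · change q ((1 : ℂ) ⊗ₜ[R] b) = z
    have h0 : q ((1 : ℂ) ⊗ₜ[R] b - algebraMap ℂ (ℂ ⊗[R] T) z) = 0 := by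
      change e.symm (Ideal.Quotient.mk m _) = 0
      rw [Ideal.Quotient.eq_zero_iff_mem.2 hbm, map_zero]
    rw [map_sub, AlgHom.commutes, sub_eq_zero] at h0
    exact h0

/-- If the coefficients of a monic complex polynomial are bounded by those of `(x + M) ^ N`, then
its roots satisfy `2 |w| ^ N ≤ (|w| + M) ^ N`. -/
theorem two_mul_norm_root_pow_le {p : Polynomial ℂ} (hp : p.Monic) {M : ℝ}
    (hc : ∀ i, ‖p.coeff i‖ ≤ M ^ (p.natDegree - i) * (p.natDegree.choose i)) {w : ℂ}
    (hw : p.IsRoot w) : 2 * ‖w‖ ^ p.natDegree ≤ (‖w‖ + M) ^ p.natDegree := by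
  have h := hw.eq_zero
  rw [Polynomial.eval_eq_sum_range, Finset.sum_range_succ, hp.coeff_natDegree, one_mul,
    add_eq_zero_iff_neg_eq'] at h
  -- The top term of the binomial expansion is one copy of `‖w‖ ^ N`; the other terms dominate the
  -- lower coefficients of `p`, whose sum at the root has modulus `‖w‖ ^ N` again.
  rw [add_pow, Finset.sum_range_succ, two_mul]
  refine add_le_add ?_ (by simp)
  rw [← norm_pow, ← norm_neg, h]
  refine (norm_sum_le _ _).trans (Finset.sum_le_sum fun i _ => ?_)
  rw [norm_mul, norm_pow, mul_assoc, mul_comm (‖w‖ ^ i)]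
  exact mul_le_mul_of_nonneg_right (hc i) (by positivity)

/-- If `M < x`, division by `x ^ (m * N)` leaves `2 ≤ (1 + (M / x) ^ m) ^ N`, and the right side
tends to `1` as `m → ∞`. -/
theorem le_of_forall_two_mul_pow_le {x M : ℝ} (hM : 0 ≤ M) (N : ℕ)
    (h : ∀ m : ℕ, 2 * (x ^ m) ^ N ≤ (x ^ m + M ^ m) ^ N) : x ≤ M := by
  by_contra! hx
  have hx0 : 0 < x := hM.trans_lt hx
  have hr : ∀ m : ℕ, 2 ≤ (1 + (M / x) ^ m) ^ N := by
    intro m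
    have hpos : 0 < (x ^ m) ^ N := by positivity
    refine le_of_mul_le_mul_right (a := (x ^ m) ^ N) ((h m).trans_eq ?_) hpos
    rw [← mul_pow, div_pow, add_mul, one_mul, div_mul_cancel₀ _ (by positivity)]
  have hlim : Filter.Tendsto (fun m : ℕ => (1 + (M / x) ^ m) ^ N) Filter.atTop
      (nhds ((1 + 0) ^ N)) :=
    ((tendsto_pow_atTop_nhds_zero_of_lt_one (by positivity) ((div_lt_one hx0).2 hx)).const_add
      1).pow N
  have := ge_of_tendsto' hlim hr
  norm_num at this

end Charpoly

/-! ### Splitting off one indeterminate -/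

section WeightedSplit

variable {A : Type u} [NormedCommRing A] {σ : Type v}

/-- Multiplication by a power of an indeterminate only shifts exponents, so submultiplicativity
becomes an equality. -/
theorem weightedNorm_mul_X_pow (t : σ → ℝ) (p : MvPolynomial σ A) (i : σ) (k : ℕ) :
    weightedNorm t (p * MvPolynomial.X i ^ k) = weightedNorm t p * t i ^ k := by
  classical
  induction k with
  | zero => simp
  | succ k ih =>
    rw [pow_succ, ← mul_assoc, weightedNorm, MvPolynomial.support_mul_X, Finset.sum_map,
      pow_succ, ← mul_assoc, ← ih, weightedNorm, Finset.sum_mul]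
    refine Finset.sum_congr rfl fun s _ => ?_
    rw [addRightEmbedding_apply, MvPolynomial.coeff_mul_X,
      Finsupp.prod_add_index' (by simp) (by intros; rw [pow_add])]
    simp [mul_assoc]

/-- The label `c` recovers the index of the summand from the exponent, so the supports are pairwise
disjoint and nothing cancels. -/
theorem weightedNorm_sum_of_disjoint {t : σ → ℝ} {ι : Type*} (F : Finset ι)
    (p : ι → MvPolynomial σ A) (c : (σ →₀ ℕ) → ι)
    (hp : ∀ k ∈ F, ∀ s ∈ (p k).support, c s = k) :
    weightedNorm t (∑ k ∈ F, p k) = ∑ k ∈ F, weightedNorm t (p k) := by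
  classical
  have hsub : (∑ k ∈ F, p k).support ⊆ F.biUnion fun k => (p k).support :=
    MvPolynomial.support_sum
  rw [weightedNorm_eq_of_subset t _ _ hsub, Finset.sum_congr rfl fun k hk =>
    weightedNorm_eq_of_subset t (p k) (F.biUnion fun k => (p k).support)
      (Finset.subset_biUnion_of_mem (fun k => (p k).support) hk), Finset.sum_comm]
  refine Finset.sum_congr rfl fun s hs => ?_
  obtain ⟨k, hk, hks⟩ := Finset.mem_biUnion.1 hs
  have h0 : ∀ j ∈ F, j ≠ k → (p j).coeff s = 0 := fun j hj hjk =>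
    MvPolynomial.notMem_support_iff.1 fun h => hjk ((hp j hj s h).symm.trans (hp k hk s hks))
  rw [MvPolynomial.coeff_sum, Finset.sum_eq_single_of_mem k hk h0,
    Finset.sum_eq_single_of_mem k hk fun j hj hjk => by rw [h0 j hj hjk, norm_zero, zero_mul]]

end WeightedSplit

section Split

variable {A : Type u} [CommRing A] {σ : Type v}

theorem mem_support_mul_X_pow {q : MvPolynomial σ A} {i : σ} {k : ℕ} {s : σ →₀ ℕ}
    (hs : s ∈ (q * MvPolynomial.X i ^ k).support) :
    ∃ m ∈ q.support, s = m + Finsupp.single i k := by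
  classical
  rw [MvPolynomial.X_pow_eq_monomial, MvPolynomial.mem_support_iff,
    MvPolynomial.coeff_mul_monomial', mul_one] at hs
  split_ifs at hs with h
  · exact ⟨s - Finsupp.single i k, MvPolynomial.mem_support_iff.2 hs,
      (tsub_add_cancel_of_le h).symm⟩
  · exact absurd rfl hs

theorem apply_eq_zero_of_notMem_vars {q : MvPolynomial σ A} {i : σ} (hi : i ∉ q.vars)
    {s : σ →₀ ℕ} (hs : s ∈ q.support) : s i = 0 := by
  by_contra h
  exact hi ((MvPolynomial.mem_vars_iff_mem_support i).2 ⟨s, hs, Finsupp.mem_support_iff.2 h⟩)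

/-- A polynomial of degree less than `n` in `x_i` is a polynomial in `x_i` whose coefficients do
not involve `x_i`. -/
theorem exists_eq_sum_mul_X_pow (q : MvPolynomial σ A) (i : σ) (n : ℕ)
    (hq : ∀ s ∈ q.support, s i < n) :
    ∃ Q : ℕ → MvPolynomial σ A, q = ∑ k ∈ Finset.range n, Q k * MvPolynomial.X i ^ k ∧
      ∀ k, ∀ m ∈ (Q k).support, ∃ s ∈ q.support, m = s.erase i := by
  classical
  refine ⟨fun k => ∑ s ∈ q.support with s i = k, MvPolynomial.monomial (s.erase i) (q.coeff s),
    ?_, fun k m hm => ?_⟩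
  · conv_lhs => rw [q.as_sum]
    rw [← Finset.sum_fiberwise_of_maps_to (g := fun s => s i) (t := Finset.range n)
      (fun s hs => Finset.mem_range.2 (hq s hs))]
    refine Finset.sum_congr rfl fun k _ => ?_
    rw [Finset.sum_mul]
    refine Finset.sum_congr rfl fun s hs => ?_
    rw [← (Finset.mem_filter.1 hs).2, MvPolynomial.X_pow_eq_monomial, MvPolynomial.monomial_mul,
      mul_one, Finsupp.erase_add_single]
  · obtain ⟨s, hs, hms⟩ := Finset.mem_biUnion.1 (MvPolynomial.support_sum hm)
    exact ⟨s, (Finset.mem_filter.1 hs).1,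
      Finset.mem_singleton.1 (MvPolynomial.support_monomial_subset hms)⟩

theorem isMinimal_iff {f : σ → Polynomial A} (hf : ∀ i, (f i).Monic ∧ 0 < (f i).natDegree)
    {q : MvPolynomial σ A} :
    IsMinimal f q ↔ ∀ i, ∀ s ∈ q.support, s i < (f i).natDegree :=
  forall_congr' fun i => MvPolynomial.degreeOf_lt_iff (hf i).2

theorem isMinimal_sum_mul_X_pow {f : σ → Polynomial A}
    (hf : ∀ i, (f i).Monic ∧ 0 < (f i).natDegree) (i : σ) {Q : ℕ → MvPolynomial σ A}
    (hQ : ∀ k, IsMinimal f (Q k)) (hi : ∀ k, i ∉ (Q k).vars) :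
    IsMinimal f (∑ k ∈ Finset.range (f i).natDegree, Q k * MvPolynomial.X i ^ k) := by
  classical
  refine (isMinimal_iff hf).2 fun j s hs => ?_
  obtain ⟨k, hk, hks⟩ := Finset.mem_biUnion.1 (MvPolynomial.support_sum hs)
  obtain ⟨m, hm, rfl⟩ := mem_support_mul_X_pow hks
  rcases eq_or_ne i j with rfl | hij
  · rw [Finsupp.add_apply, apply_eq_zero_of_notMem_vars (hi k) hm, zero_add,
      Finsupp.single_eq_same]
    exact Finset.mem_range.1 hk
  · rw [Finsupp.add_apply, Finsupp.single_eq_of_ne hij.symm, add_zero]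
    exact (isMinimal_iff hf).1 (hQ k) j m hm

/-- Each power of `x_i` is replaced by a polynomial in the same `x_i`, so reduction introduces no
new indeterminates. This keeps minimal representatives inside an initial segment of `U`. -/
theorem reduce_mem_supported {f : σ → Polynomial A} {V : Set σ} {q : MvPolynomial σ A}
    (hq : q ∈ MvPolynomial.supported A V) : reduce f q ∈ MvPolynomial.supported A V := by
  rw [q.as_sum, map_sum]
  refine Subalgebra.sum_mem _ fun s hs => ?_
  rw [reduce_monomial]
  refine Subalgebra.smul_mem _ (Subalgebra.prod_mem _ fun i hi => ?_) _
  have hX : (MvPolynomial.X i : MvPolynomial σ A) ∈ MvPolynomial.supported A V :=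
    Algebra.subset_adjoin ⟨i, MvPolynomial.mem_supported.1 hq
      ((MvPolynomial.mem_vars_iff_mem_support i).2 ⟨s, hs, hi⟩), rfl⟩
  exact Algebra.adjoin_le (Set.singleton_subset_iff.2 hX)
    (Polynomial.aeval_mem_adjoin_singleton _ _)

theorem reduce_rename {τ : Type*} {g : σ → τ} (hg : Function.Injective g) (f : τ → Polynomial A)
    (q : MvPolynomial σ A) : reduce f (MvPolynomial.rename g q) =
      MvPolynomial.rename g (reduce (fun i => f (g i)) q) := by
  induction q using MvPolynomial.induction_on' with
  | monomial s a =>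
    rw [MvPolynomial.rename_monomial, reduce_monomial, reduce_monomial, map_smul,
      Finsupp.prod_mapDomain_index_inj hg, Finsupp.prod, Finsupp.prod, map_prod]
    refine congrArg _ (Finset.prod_congr rfl fun i _ => ?_)
    rw [← Polynomial.aeval_algHom_apply, MvPolynomial.rename_X]
  | add p q hp hq => rw [map_add, map_add, map_add, map_add, hp, hq]

end Split

section SplitNorm

variable {A : Type u} [NormedCommRing A] {σ : Type v}

/-- The exponent of `x_i` tells the terms apart. The right side has the shape of an Arens–Hoffman
norm, which is the link between the two kinds of extension. -/
theorem weightedNorm_sum_mul_X_pow (t : σ → ℝ) (i : σ) (n : ℕ) {Q : ℕ → MvPolynomial σ A}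
    (hi : ∀ k, i ∉ (Q k).vars) :
    weightedNorm t (∑ k ∈ Finset.range n, Q k * MvPolynomial.X i ^ k) =
      ∑ k ∈ Finset.range n, weightedNorm t (Q k) * t i ^ k := by
  rw [weightedNorm_sum_of_disjoint _ _ fun s => s i]
  · exact Finset.sum_congr rfl fun k _ => weightedNorm_mul_X_pow t _ i k
  · intro k _ s hs
    obtain ⟨m, hm, rfl⟩ := mem_support_mul_X_pow hs
    rw [Finsupp.add_apply, apply_eq_zero_of_notMem_vars (hi k) hm, zero_add,
      Finsupp.single_eq_same]

end SplitNorm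

/-! ### The quotients by the relations are free, and finite for finitely many indeterminates -/

section FiniteFree

variable {A : Type u} [CommRing A] {σ : Type v} {f : σ → Polynomial A}

/-- The minimal polynomials, as a module, are the quotient by the relations. -/
def minimalEquiv (hf : ∀ i, (f i).Monic ∧ 0 < (f i).natDegree) :
    MvPolynomial.restrictSupport A {s : σ →₀ ℕ | ∀ i, s i < (f i).natDegree} ≃ₗ[A]
      MvPolynomial σ A ⧸ relIdeal f :=
  have hmem : ∀ q : MvPolynomial σ A,
      q ∈ MvPolynomial.restrictSupport A {s : σ →₀ ℕ | ∀ i, s i < (f i).natDegree} ↔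
        IsMinimal f q := fun q => by
    rw [isMinimal_iff hf, MvPolynomial.mem_restrictSupport_iff]
    exact ⟨fun h i s hs => h hs i, fun h s hs i => h i s hs⟩
  LinearEquiv.ofBijective
    ((Ideal.Quotient.mkₐ A (relIdeal f)).toLinearMap.comp (Submodule.subtype _)) <| by
    constructor
    · intro p q hpq
      exact Subtype.ext ((existsUnique_isMinimal hf _).unique
        ⟨(hmem _).1 p.2, hpq⟩ ⟨(hmem _).1 q.2, rfl⟩)
    · intro z
      obtain ⟨q, hq, hz⟩ := (existsUnique_isMinimal hf z).exists
      exact ⟨⟨q, (hmem q).2 hq⟩, hz⟩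

theorem free_quotient_relIdeal (hf : ∀ i, (f i).Monic ∧ 0 < (f i).natDegree) :
    Module.Free A (MvPolynomial σ A ⧸ relIdeal f) :=
  Module.Free.of_basis ((MvPolynomial.basisRestrictSupport A _).map (minimalEquiv hf))

theorem finite_quotient_relIdeal [Finite σ] (hf : ∀ i, (f i).Monic ∧ 0 < (f i).natDegree) :
    Module.Finite A (MvPolynomial σ A ⧸ relIdeal f) := by
  have hfin : {s : σ →₀ ℕ | ∀ i, s i < (f i).natDegree}.Finite := by
    exact (Set.Finite.pi' fun i => Set.finite_Iio (f i).natDegree).preimage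
      DFunLike.coe_injective.injOn
  have := hfin.to_subtype
  exact Module.Finite.of_basis ((MvPolynomial.basisRestrictSupport A _).map (minimalEquiv hf))

end FiniteFree

/-! ### The direct limit as a quotient of the polynomials in all indeterminates -/

section Reduced

variable {A : Type u} [NormedCommRing A] {U : Set (Polynomial A)}

theorem IsMonicSet.family (hU : IsMonicSet U) (α : U) : α.1.Monic ∧ 0 < α.1.natDegree :=
  hU α.1 α.2

theorem map_reduce_of_roots {R : Type*} [CommRing R] (f : MvPolynomial U A →+* R)
    (hf : ∀ α : U, f (Polynomial.aeval (MvPolynomial.X α) α.1) = 0) (q : MvPolynomial U A) :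
    f (reduce (fun α : U => α.1) q) = f q := by
  have hle : relIdeal (fun α : U => α.1) ≤ RingHom.ker f := by
    refine Ideal.span_le.2 ?_
    rintro _ ⟨α, rfl⟩
    exact RingHom.mem_ker.2 (hf α)
  have := hle (Ideal.Quotient.eq.1 (mk_reduce (f := fun α : U => α.1) q))
  rwa [RingHom.mem_ker, map_sub, sub_eq_zero] at this

end Reduced

section Limit

variable {A : Type u} [NormedCommRing A] {U : Set (Polynomial A)} (hU : IsMonicSet U) {t : U → ℝ}
  (ht : IsNormParameter U t) [NormedAlgebra ℂ A]

namespace LimitExt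

/-- The presentation of the direct limit by the polynomials in all indeterminates. -/
def ofPoly : MvPolynomial U A →ₐ[ℂ] LimitExt hU ht :=
  MvPolynomial.aevalTower ({ inclusion hU ht with commutes' := fun _ => rfl } :
    A →ₐ[ℂ] LimitExt hU ht) (root hU ht)

theorem ofPoly_C (a : A) : ofPoly hU ht (MvPolynomial.C a) = inclusion hU ht a :=
  MvPolynomial.aevalTower_C _ _ _

theorem ofPoly_X (α : U) : ofPoly hU ht (MvPolynomial.X α) = root hU ht α :=
  MvPolynomial.aevalTower_X _ _ _

theorem ofPoly_rename (S : Finset U) (q : MvPolynomial S A) :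
    ofPoly hU ht (MvPolynomial.rename (fun α : S => α.1) q) =
      of hU ht S (Ideal.Quotient.mk (relIdeal (finFamily S)) q) := by
  induction q using MvPolynomial.induction_on with
  | C a =>
    rw [MvPolynomial.rename_C, ofPoly_C, ← of_algebraMap hU ht S]
    rfl
  | add p q hp hq => rw [map_add, map_add, hp, hq, map_add, map_add]
  | mul_X p α hp =>
    rw [map_mul, map_mul, hp, map_mul, map_mul, MvPolynomial.rename_X, ofPoly_X, root,
      ← of_transition hU ht (Finset.singleton_subset_iff.2 α.2), FinExt.transition_mk,
      MvPolynomial.rename_X]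

theorem ofPoly_surjective : Function.Surjective (ofPoly hU ht) := by
  intro x
  obtain ⟨S, z, rfl⟩ := exists_of hU ht x
  obtain ⟨q, rfl⟩ := Ideal.Quotient.mk_surjective z
  exact ⟨_, ofPoly_rename hU ht S q⟩

/-- A polynomial involves finitely many indeterminates, and reduction commutes with injective
renaming, so a single formula over `U` replaces the compatible norms of the `A_S`. -/
theorem norm_ofPoly (q : MvPolynomial U A) :
    ‖ofPoly hU ht q‖ = weightedNorm t (reduce (fun α : U => α.1) q) := by
  obtain ⟨S, q, rfl⟩ := MvPolynomial.exists_finset_rename q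
  rw [ofPoly_rename, norm_of, FinExt.norm, FinExt.minimalRep_mk,
    reduce_rename Subtype.val_injective, weightedNorm_rename Subtype.val_injective]
  rfl

end LimitExt

end Limit

/-! ### The norm of a standard extension -/

section StandardNorm

variable {A : Type u} [NormedCommRing A] {U : Set (Polynomial A)} {hU : IsMonicSet U} {t : U → ℝ}
  {r : U → U → Prop} {B : Type*} [NormedCommRing B] [Algebra A B]

theorem IsMonicSet.natDegree_map_of_injective (hU : IsMonicSet U) (β : U)
    {C : Type*} [CommRing C] [Algebra A C] (hC : Function.Injective (algebraMap A C)) :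
    (β.1.map (algebraMap A C)).natDegree = β.1.natDegree := by
  -- Over a trivial ring every polynomial has degree `0`, so the positive degree of `β` forces `A`,
  -- and with it `C`, to be nontrivial.
  have : Nontrivial A := by
    by_contra h
    rw [not_nontrivial_iff_subsingleton] at h
    have := (hU β.1 β.2).2
    rw [Polynomial.natDegree_of_subsingleton] at this
    exact this.false
  have : Nontrivial C := hC.nontrivial
  exact (hU β.1 β.2).1.natDegree_map _

theorem arensHoffmanNorm_mk_sum {C : Type*} [NormedCommRing C] {p : Polynomial C} (hp : p.Monic)
    (s : ℝ) (b : ℕ → C) :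
    arensHoffmanNorm hp s (AdjoinRoot.mk p (∑ k ∈ Finset.range p.natDegree,
      Polynomial.C (b k) * Polynomial.X ^ k)) =
        ∑ k ∈ Finset.range p.natDegree, ‖b k‖ * s ^ k := by
  rcases subsingleton_or_nontrivial C with hC | hC
  · simp [arensHoffmanNorm, Polynomial.natDegree_of_subsingleton]
  have hdeg : (∑ k ∈ Finset.range p.natDegree, Polynomial.C (b k) * Polynomial.X ^ k).degree <
      p.degree := by
    rw [Polynomial.degree_eq_natDegree hp.ne_zero, ← Fin.sum_univ_eq_sum_range
      (fun k => Polynomial.C (b k) * Polynomial.X ^ k)]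
    exact Polynomial.degree_sum_fin_lt fun i : Fin p.natDegree => b i
  rw [arensHoffmanNorm, AdjoinRoot.modByMonicHom_mk, (Polynomial.modByMonic_eq_self_iff hp).2 hdeg]
  refine Finset.sum_congr rfl fun k hk => ?_
  simp only [Polynomial.finsetSum_coeff, Polynomial.coeff_C_mul, Polynomial.coeff_X_pow,
    mul_ite, mul_one, mul_zero]
  rw [Finset.sum_ite_eq, if_pos hk]

namespace StandardExtension

variable (E : StandardExtension hU t r B)

theorem algebraMap_injective (E : StandardExtension hU t r B) :
    Function.Injective (algebraMap A B) :=
  (injective_iff_map_eq_zero _).2 fun a ha => by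
    rw [← norm_eq_zero, ← E.norm_algebraMap, ha, norm_zero]

theorem algebraMap_below_injective (β : U) :
    Function.Injective (algebraMap A (below r E.sub β)) := fun _ _ h =>
  E.algebraMap_injective (congrArg Subtype.val h)

theorem psi_mk (β : U) (p : Polynomial (below r E.sub β)) :
    E.psi β (AdjoinRoot.mk _ p) = Polynomial.aeval (E.root β) p := by
  rw [root, Polynomial.aeval_algHom_apply, AdjoinRoot.aeval_eq]

theorem root_mem_sub (β : U) : E.root β ∈ E.sub β := by
  rw [← SetLike.mem_coe, ← E.range_psi]
  exact ⟨_, rfl⟩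

theorem aeval_root (β : U) : Polynomial.aeval (E.root β) β.1 = 0 := by
  have h := E.psi_mk β (β.1.map (algebraMap A (below r E.sub β)))
  rw [AdjoinRoot.mk_self, map_zero, Polynomial.aeval_map_algebraMap] at h
  exact h.symm

theorem root_mem_below {α β : U} (h : r α β) : E.root α ∈ below r E.sub β :=
  (le_iSup₂_of_le (f := fun α (_ : r α β) => E.sub α) α h le_rfl :
    E.sub α ≤ below r E.sub β) (E.root_mem_sub α)

theorem aeval_mem_below {β : U} {q : MvPolynomial U A}
    (hq : q ∈ MvPolynomial.supported A {α | r α β}) :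
    MvPolynomial.aeval E.root q ∈ below r E.sub β := by
  have : (MvPolynomial.supported A {α | r α β}).map (MvPolynomial.aeval E.root) ≤
      below r E.sub β := by
    rw [MvPolynomial.supported, AlgHom.map_adjoin]
    refine Algebra.adjoin_le ?_
    rintro _ ⟨_, ⟨α, hα, rfl⟩, rfl⟩
    rw [MvPolynomial.aeval_X]
    exact E.root_mem_below hα
  exact this ⟨q, hq, rfl⟩

/-- This is the isometry of `ψ_β`, written for elements of `B`: a sum of powers below the degree is
its own remainder. -/
theorem norm_sum_mul_root_pow (β : U) (b : ℕ → below r E.sub β) :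
    ‖∑ k ∈ Finset.range β.1.natDegree, (b k : B) * E.root β ^ k‖ =
      ∑ k ∈ Finset.range β.1.natDegree, ‖(b k : B)‖ * t β ^ k := by
  have hdeg := hU.natDegree_map_of_injective β (E.algebraMap_below_injective β)
  have h := arensHoffmanNorm_mk_sum ((hU β.1 β.2).1.map (algebraMap A (below r E.sub β))) (t β) b
  rw [← E.norm_psi, psi_mk, hdeg] at h
  rw [map_sum] at h
  simp only [map_mul, Polynomial.aeval_C, map_pow, Polynomial.aeval_X] at h
  exact h

/-- Ordinary induction on the number of indeterminates suffices, because a polynomial has an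
`r`-largest one, `β`. As a polynomial in `x_β` it has minimal coefficients in earlier
indeterminates; their values lie in `B_{<β}`, and the Arens–Hoffman norm at stage `β` adds up their
norms with the weights `t β ^ k`. -/
theorem norm_aeval_of_isMinimal [IsWellOrder U r] (n : ℕ) : ∀ q : MvPolynomial U A,
    q.vars.card = n → IsMinimal (fun α : U => α.1) q →
      ‖MvPolynomial.aeval E.root q‖ = weightedNorm t q := by
  classical
  induction n using Nat.strong_induction_on with
  | _ n ih =>
    intro q hn hq
    -- The strict order of this linear order is `r` itself, so an inequality `γ < β` is a proof of
    -- `r γ β`.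
    let _ : LinearOrder U := linearOrderOfSTO r
    rcases q.vars.eq_empty_or_nonempty with h0 | hne
    · rw [MvPolynomial.vars_eq_empty_iff_eq_C.1 h0, MvPolynomial.aeval_C, E.norm_algebraMap,
        MvPolynomial.C_apply, weightedNorm_monomial, Finsupp.prod_zero_index, mul_one]
    · set β := q.vars.max' hne with hβ
      obtain ⟨Q, hqQ, hQ⟩ := exists_eq_sum_mul_X_pow q β β.1.natDegree
        ((isMinimal_iff hU.family).1 hq β)
      have hvars : ∀ k, (Q k).vars ⊆ q.vars.erase β := by
        intro k γ hγ
        obtain ⟨m, hm, hγm⟩ := (MvPolynomial.mem_vars_iff_mem_support γ).1 hγ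
        obtain ⟨s, hs, rfl⟩ := hQ k m hm
        rw [Finsupp.support_erase, Finset.mem_erase] at hγm
        exact Finset.mem_erase.2
          ⟨hγm.1, (MvPolynomial.mem_vars_iff_mem_support γ).2 ⟨s, hs, hγm.2⟩⟩
      have hβQ : ∀ k, β ∉ (Q k).vars := fun k h => Finset.notMem_erase β _ (hvars k h)
      have hmin : ∀ k, IsMinimal (fun α : U => α.1) (Q k) := by
        refine fun k => (isMinimal_iff hU.family).2 fun γ m hm => ?_
        obtain ⟨s, hs, rfl⟩ := hQ k m hm
        refine lt_of_le_of_lt ?_ ((isMinimal_iff hU.family).1 hq γ s hs)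
        rw [Finsupp.erase_apply]
        split_ifs
        · exact Nat.zero_le _
        · exact le_rfl
      have hbelow : ∀ k, MvPolynomial.aeval E.root (Q k) ∈ below r E.sub β := by
        refine fun k => E.aeval_mem_below (MvPolynomial.mem_supported.2 fun γ hγ => ?_)
        have h1 := Finset.mem_erase.1 (hvars k hγ)
        exact lt_of_le_of_ne (Finset.le_max' _ γ h1.2) h1.1
      have hnorm : ∀ k, ‖MvPolynomial.aeval E.root (Q k)‖ = weightedNorm t (Q k) := by
        refine fun k => ih _ ?_ (Q k) rfl (hmin k)
        rw [← hn]
        exact (Finset.card_le_card (hvars k)).trans_lt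
          (Finset.card_erase_lt_of_mem (Finset.max'_mem _ _))
      conv_rhs => rw [hqQ]
      conv_lhs => rw [hqQ]
      rw [weightedNorm_sum_mul_X_pow t β _ hβQ, map_sum]
      simp only [map_mul, map_pow, MvPolynomial.aeval_X]
      rw [E.norm_sum_mul_root_pow β fun k => ⟨_, hbelow k⟩]
      exact Finset.sum_congr rfl fun k _ => by rw [hnorm k]

theorem norm_aeval [IsWellOrder U r] (q : MvPolynomial U A) :
    ‖MvPolynomial.aeval E.root q‖ = weightedNorm t (reduce (fun α : U => α.1) q) := by
  rw [← E.norm_aeval_of_isMinimal _ _ rfl (isMinimal_reduce hU.family q)]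
  congr 1
  refine (map_reduce_of_roots (MvPolynomial.aeval E.root : MvPolynomial U A →ₐ[A] B).toRingHom
    (fun α => ?_) q).symm
  change MvPolynomial.aeval E.root _ = 0
  rw [← Polynomial.aeval_algHom_apply, MvPolynomial.aeval_X, E.aeval_root]

/-- Well-founded induction along `r`: the elements of `B_β` are polynomials in the root of `β` over
`B_{<β}`, which is generated by the earlier stages. -/
theorem aeval_surjective [IsWellOrder U r] :
    Function.Surjective (MvPolynomial.aeval E.root : MvPolynomial U A →ₐ[A] B) := by
  rw [← AlgHom.range_eq_top, ← top_le_iff, ← E.iSup_sub]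
  refine iSup_le fun β => ?_
  induction β using (IsWellFounded.wf (r := r)).induction with
  | _ β ih =>
    have hb : below r E.sub β ≤ (MvPolynomial.aeval E.root : MvPolynomial U A →ₐ[A] B).range :=
      iSup₂_le ih
    intro x hx
    rw [← SetLike.mem_coe, ← E.range_psi] at hx
    obtain ⟨z, rfl⟩ := hx
    obtain ⟨p, rfl⟩ := AdjoinRoot.mk_surjective z
    rw [psi_mk, Polynomial.aeval_eq_sum_range]
    refine Subalgebra.sum_mem _ fun k _ => ?_
    rw [Algebra.smul_def]
    refine Subalgebra.mul_mem _ (hb (p.coeff k).2) (Subalgebra.pow_mem _ ?_ _)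
    exact ⟨MvPolynomial.X β, MvPolynomial.aeval_X _ _⟩

end StandardExtension

end StandardNorm

/-! ### The direct limit as a standard extension -/

section Existence

variable {A : Type u} [NormedCommRing A] {U : Set (Polynomial A)}
  (hU : IsMonicSet U) {t : U → ℝ} (ht : IsNormParameter U t)

namespace LimitExt

instance baseAlgebra : Algebra A (LimitExt hU ht) := (inclusion hU ht).toAlgebra

/-- The subalgebra of the direct limit generated by the roots of the polynomials in `V`. -/
def adjoinRoots (V : Set U) : Subalgebra A (LimitExt hU ht) :=
  (MvPolynomial.supported A V).map (MvPolynomial.aeval (root hU ht))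

theorem root_mem_adjoinRoots {V : Set U} {α : U} (h : α ∈ V) :
    root hU ht α ∈ adjoinRoots hU ht V :=
  ⟨MvPolynomial.X α, Algebra.subset_adjoin ⟨α, h, rfl⟩, MvPolynomial.aeval_X _ _⟩

theorem adjoinRoots_le {V : Set U} {S : Subalgebra A (LimitExt hU ht)}
    (h : ∀ α ∈ V, root hU ht α ∈ S) : adjoinRoots hU ht V ≤ S := by
  rw [adjoinRoots, MvPolynomial.supported, AlgHom.map_adjoin]
  refine Algebra.adjoin_le ?_
  rintro _ ⟨_, ⟨α, hα, rfl⟩, rfl⟩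
  simpa using h α hα

theorem adjoinRoots_mono {V W : Set U} (h : V ⊆ W) :
    adjoinRoots hU ht V ≤ adjoinRoots hU ht W :=
  adjoinRoots_le hU ht fun _ hα => root_mem_adjoinRoots hU ht (h hα)

/-- The subalgebra generated by the roots of `β` and of the preceding polynomials. -/
def initialSub (r : U → U → Prop) (β : U) : Subalgebra A (LimitExt hU ht) :=
  adjoinRoots hU ht {γ | r γ β ∨ γ = β}

theorem below_initialSub (r : U → U → Prop) [IsTrans U r] (β : U) :
    below r (initialSub hU ht r) β = adjoinRoots hU ht {γ | r γ β} := by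
  refine le_antisymm (iSup₂_le fun α hα => adjoinRoots_mono hU ht ?_)
    (adjoinRoots_le hU ht fun γ hγ => ?_)
  · rintro γ (hγ | rfl)
    · exact _root_.trans hγ hα
    · exact hα
  · exact (le_iSup₂_of_le (f := fun α (_ : r α β) => initialSub hU ht r α) γ hγ le_rfl :
      initialSub hU ht r γ ≤ below r (initialSub hU ht r) β)
        (root_mem_adjoinRoots hU ht (Or.inr rfl))

variable [NormedAlgebra ℂ A]

instance : IsScalarTower ℂ A (LimitExt hU ht) := IsScalarTower.of_algebraMap_eq fun _ => rfl

theorem aeval_root_eq_ofPoly (q : MvPolynomial U A) :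
    MvPolynomial.aeval (root hU ht) q = ofPoly hU ht q := by
  induction q using MvPolynomial.induction_on with
  | C a =>
    rw [MvPolynomial.aeval_C, ofPoly_C]
    rfl
  | add p q hp hq => rw [map_add, map_add, hp, hq]
  | mul_X p α hp => rw [map_mul, map_mul, hp, ofPoly_X, MvPolynomial.aeval_X]

theorem norm_aeval (q : MvPolynomial U A) :
    ‖MvPolynomial.aeval (root hU ht) q‖ = weightedNorm t (reduce (fun α : U => α.1) q) := by
  rw [aeval_root_eq_ofPoly, norm_ofPoly]

/-- As the norm on the direct limit is known in terms of `reduce`, identities there, such as this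
one and `aeval_root`, follow by computing that the difference has norm `0`. -/
theorem aeval_reduce (q : MvPolynomial U A) :
    MvPolynomial.aeval (root hU ht) (reduce (fun α : U => α.1) q) =
      MvPolynomial.aeval (root hU ht) q := by
  have h : ‖MvPolynomial.aeval (root hU ht) (reduce (fun α : U => α.1) q - q)‖ = 0 := by
    rw [norm_aeval, map_sub, reduce_of_isMinimal hU.family (isMinimal_reduce hU.family q),
      sub_self, weightedNorm_zero]
  rwa [norm_eq_zero, map_sub, sub_eq_zero] at h

theorem aeval_root (β : U) : Polynomial.aeval (root hU ht β) β.1 = 0 := by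
  have h : ‖MvPolynomial.aeval (root hU ht)
      (Polynomial.aeval (MvPolynomial.X β : MvPolynomial U A) β.1)‖ = 0 := by
    rw [norm_aeval, reduce_eq_zero hU.family (Ideal.subset_span ⟨β, rfl⟩), weightedNorm_zero]
  rwa [norm_eq_zero, ← Polynomial.aeval_algHom_apply, MvPolynomial.aeval_X] at h

theorem norm_inclusion (a : A) : ‖inclusion hU ht a‖ = ‖a‖ := by
  have hmin : IsMinimal (fun α : U => α.1) (MvPolynomial.C a : MvPolynomial U A) := fun i => by
    rw [MvPolynomial.degreeOf_C]
    exact (hU.family i).2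
  rw [← ofPoly_C, norm_ofPoly, reduce_of_isMinimal hU.family hmin, MvPolynomial.C_apply,
    weightedNorm_monomial, Finsupp.prod_zero_index, mul_one]

theorem adjoinRoots_univ : adjoinRoots hU ht Set.univ = ⊤ := by
  rw [eq_top_iff]
  intro x _
  obtain ⟨q, rfl⟩ := ofPoly_surjective hU ht x
  exact ⟨q, MvPolynomial.mem_supported.2 (Set.subset_univ _), aeval_root_eq_ofPoly hU ht q⟩

/-- Elements generated by the roots in `V` have minimal representatives without `x_β`. Multiplied by
powers of `x_β` below the degree they again add up to a minimal polynomial, whose weighted norm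
splits. -/
theorem norm_sum_mul_root_pow {V : Set U} {β : U} (hβ : β ∉ V) {b : ℕ → LimitExt hU ht}
    (hb : ∀ k, b k ∈ adjoinRoots hU ht V) :
    ‖∑ k ∈ Finset.range β.1.natDegree, b k * root hU ht β ^ k‖ =
      ∑ k ∈ Finset.range β.1.natDegree, ‖b k‖ * t β ^ k := by
  have hQ : ∀ k, ∃ Q : MvPolynomial U A, IsMinimal (fun α : U => α.1) Q ∧ β ∉ Q.vars ∧
      MvPolynomial.aeval (root hU ht) Q = b k := by
    intro k
    obtain ⟨q, hq, hqb⟩ := hb k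
    refine ⟨reduce (fun α : U => α.1) q, isMinimal_reduce hU.family q, fun h => ?_, ?_⟩
    · exact hβ (MvPolynomial.mem_supported.1 (reduce_mem_supported hq) h)
    · rw [aeval_reduce]
      exact hqb
  choose Q hmin hvars hQb using hQ
  have hsum : ∑ k ∈ Finset.range β.1.natDegree, b k * root hU ht β ^ k =
      MvPolynomial.aeval (root hU ht)
        (∑ k ∈ Finset.range β.1.natDegree, Q k * MvPolynomial.X β ^ k) := by
    simp only [map_sum, map_mul, map_pow, MvPolynomial.aeval_X, hQb]
  rw [hsum, norm_aeval, reduce_of_isMinimal hU.family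
    (isMinimal_sum_mul_X_pow hU.family β hmin hvars), weightedNorm_sum_mul_X_pow t β _ hvars]
  refine Finset.sum_congr rfl fun k _ => ?_
  rw [← hQb, norm_aeval, reduce_of_isMinimal hU.family (hmin k)]

variable (r : U → U → Prop)

/-- The homomorphism from the Arens-Hoffman extension of `B_{<β}` by `β` that maps `x̄` to the
root of `β`. -/
def adjoinRootHom (β : U) :
    AdjoinRoot (β.1.map (algebraMap A (below r (initialSub hU ht r) β))) →ₐ[
      below r (initialSub hU ht r) β] LimitExt hU ht :=
  AdjoinRoot.liftAlgHom _ (Algebra.ofId _ _) (root hU ht β) (by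
    rw [Polynomial.eval₂_map]
    exact aeval_root hU ht β)

theorem adjoinRootHom_mk (β : U) (p : Polynomial (below r (initialSub hU ht r) β)) :
    adjoinRootHom hU ht r β (AdjoinRoot.mk _ p) = Polynomial.aeval (root hU ht β) p := by
  rw [adjoinRootHom, AdjoinRoot.liftAlgHom_mk]
  rfl

theorem adjoinRootHom_root (β : U) :
    adjoinRootHom hU ht r β (AdjoinRoot.root _) = root hU ht β := by
  rw [AdjoinRoot.root, adjoinRootHom_mk, Polynomial.aeval_X]

theorem range_adjoinRootHom [IsTrans U r] (β : U) :
    Set.range (adjoinRootHom hU ht r β) = initialSub hU ht r β := by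
  refine Set.Subset.antisymm ?_ ?_
  · rintro _ ⟨z, rfl⟩
    obtain ⟨p, rfl⟩ := AdjoinRoot.mk_surjective z
    rw [adjoinRootHom_mk, Polynomial.aeval_eq_sum_range]
    refine Subalgebra.sum_mem _ fun k _ => ?_
    rw [Algebra.smul_def]
    refine Subalgebra.mul_mem _ ?_
      (Subalgebra.pow_mem _ (root_mem_adjoinRoots hU ht (Or.inr rfl)) _)
    refine adjoinRoots_mono hU ht (V := {γ | r γ β}) (fun _ => Or.inl) ?_
    rw [← below_initialSub]
    exact (p.coeff k).2
  -- The roots of earlier polynomials are scalars from `B_{<β}`, and the root of `β` is the image of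
  -- `x̄`.
  · refine adjoinRoots_le hU ht (S := (adjoinRootHom hU ht r β).range.restrictScalars A) ?_
    rintro γ (hγ | rfl)
    · have hmem : root hU ht γ ∈ below r (initialSub hU ht r) β := by
        rw [below_initialSub]
        exact root_mem_adjoinRoots hU ht hγ
      exact ⟨algebraMap _ _ (⟨_, hmem⟩ : below r (initialSub hU ht r) β), AlgHom.commutes _ _⟩
    · exact ⟨_, adjoinRootHom_root hU ht r γ⟩

theorem norm_adjoinRootHom [IsTrans U r] [Std.Irrefl r] (β : U)
    (z : AdjoinRoot (β.1.map (algebraMap A (below r (initialSub hU ht r) β)))) :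
    ‖adjoinRootHom hU ht r β z‖ = arensHoffmanNorm
      ((hU β.1 β.2).1.map (algebraMap A (below r (initialSub hU ht r) β))) (t β) z := by
  have hinj : Function.Injective (algebraMap A (below r (initialSub hU ht r) β)) :=
    (injective_iff_map_eq_zero _).2 fun a ha => by
      rw [← norm_eq_zero, ← norm_inclusion hU ht]
      exact norm_eq_zero.2 (congrArg Subtype.val ha)
  have hdeg := hU.natDegree_map_of_injective β hinj
  have hmonic := (hU β.1 β.2).1.map (algebraMap A (below r (initialSub hU ht r) β))
  have : Nontrivial (below r (initialSub hU ht r) β) := by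
    by_contra h
    rw [not_nontrivial_iff_subsingleton] at h
    have h0 := (hU β.1 β.2).2
    rw [← hdeg, Polynomial.natDegree_of_subsingleton] at h0
    exact h0.false
  set p := AdjoinRoot.modByMonicHom hmonic z with hp
  have hz : AdjoinRoot.mk _ p = z := AdjoinRoot.mk_leftInverse hmonic z
  have hpdeg : p.natDegree < β.1.natDegree := by
    obtain ⟨p', rfl⟩ := AdjoinRoot.mk_surjective z
    rw [hp, AdjoinRoot.modByMonicHom_mk, ← hdeg]
    refine Polynomial.natDegree_modByMonic_lt _ hmonic fun h1 => ?_
    have h0 := (hU β.1 β.2).2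
    rw [← hdeg, h1, Polynomial.natDegree_one] at h0
    exact h0.false
  rw [arensHoffmanNorm, ← hp, hdeg]
  conv_lhs => rw [← hz, adjoinRootHom_mk, Polynomial.aeval_eq_sum_range' hpdeg]
  -- Irreflexivity of `r` keeps `β` out of the indeterminates allowed in the coefficients.
  exact norm_sum_mul_root_pow hU ht (V := {γ | r γ β}) (irrefl_of r β)
    (b := fun k => (p.coeff k : LimitExt hU ht)) fun k => by
      rw [← below_initialSub]
      exact (p.coeff k).2

/-- The direct limit is a standard extension. -/
def standardExtension [IsWellOrder U r] : StandardExtension hU t r (LimitExt hU ht) where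
  norm_algebraMap := norm_inclusion hU ht
  sub := initialSub hU ht r
  mono α β h := adjoinRoots_mono hU ht <| by
    rintro γ (hγ | rfl)
    · exact Or.inl (_root_.trans hγ h)
    · exact Or.inl h
  psi := adjoinRootHom hU ht r
  range_psi := range_adjoinRootHom hU ht r
  norm_psi := norm_adjoinRootHom hU ht r
  iSup_sub := by
    rw [← top_le_iff, ← adjoinRoots_univ hU ht]
    exact adjoinRoots_le hU ht fun α _ =>
      le_iSup (initialSub hU ht r) α (root_mem_adjoinRoots hU ht (Or.inr rfl))

end LimitExt

end Existence

/-! ### Characters of finite free extensions are controlled by a norming family -/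

section FiniteExtension

/-- A character of a finite free extension is bounded by the characters that lie over a norming
family of characters of the base. -/
theorem norm_apply_le_of_norming {A T : Type*} [NormedCommRing A] [CommRing T] [Algebra A T]
    [Module.Free A T] [Module.Finite A T] {ι : Type*} (κ : ι → A →+* ℂ)
    (hκ : ∀ (a : A) (c : ℝ), 0 ≤ c → (∀ i, ‖κ i a‖ ≤ c) → ‖a‖ ≤ c) {b : T} {M : ℝ} (hM : 0 ≤ M)
    (hb : ∀ (i : ι) (χ : T →+* ℂ), (∀ a, χ (algebraMap A T a) = κ i a) → ‖χ b‖ ≤ M)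
    (χ : T →+* ℂ) (hχ : ∀ a, ‖χ (algebraMap A T a)‖ ≤ ‖a‖) : ‖χ b‖ ≤ M := by
  have : Nontrivial A := (χ.comp (algebraMap A T)).domain_nontrivial
  -- For `b` alone the root estimate loses a constant that depends on the rank; applied to all
  -- powers `b ^ m` it loses nothing in the limit.
  refine le_of_forall_two_mul_pow_le hM (Module.finrank A T) fun m => ?_
  set p := (Algebra.lmul A T (b ^ m)).charpoly with hp
  have hpm : p.Monic := LinearMap.charpoly_monic _
  have hpd : p.natDegree = Module.finrank A T := LinearMap.charpoly_natDegree _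
  have hcoeff : ∀ i, ‖p.coeff i‖ ≤ (M ^ m) ^ (p.natDegree - i) * (p.natDegree.choose i) := by
    intro i
    -- Being elements of `A`, the coefficients may be estimated at the norming characters `κ j`,
    -- where the roots of `p` are values of `b ^ m` at characters over `κ j`, of modulus at most `M
    -- ^ m`. The resulting norm bound then passes to the character below `χ`.
    refine hκ _ _ (by positivity) fun j => ?_
    rw [← Polynomial.coeff_map]
    refine Polynomial.coeff_le_of_roots_le i hpm (IsAlgClosed.splits _) fun z hz => ?_
    obtain ⟨χ', hχ', rfl⟩ := exists_ringHom_of_isRoot_charpoly (b ^ m) (κ j) z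
      (Polynomial.isRoot_of_mem_roots hz)
    rw [map_pow, norm_pow]
    exact pow_le_pow_left₀ (norm_nonneg _) (hb j χ' hχ') m
  -- Cayley–Hamilton: `b ^ m` is a root of its own characteristic polynomial; now apply `χ`.
  have hroot : (p.map (χ.comp (algebraMap A T))).IsRoot (χ (b ^ m)) := by
    have h := congrArg χ (Algebra.aeval_self_charpoly_lmul (R := A) (b ^ m))
    rw [Polynomial.aeval_def, Polynomial.hom_eval₂, map_zero] at h
    rwa [Polynomial.IsRoot, Polynomial.eval_map]
  have hpd' : (p.map (χ.comp (algebraMap A T))).natDegree = p.natDegree := hpm.natDegree_map _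
  have h := two_mul_norm_root_pow_le (hpm.map _) (M := M ^ m) (fun i => by
    rw [hpd', Polynomial.coeff_map]
    exact (hχ _).trans (hcoeff i)) hroot
  rwa [hpd', hpd, map_pow, norm_pow] at h

variable {A : Type u} [NormedCommRing A] {U : Set (Polynomial A)} (S : Finset U)

theorem exists_finExt_ringHom (χ : MvPolynomial U A →+* ℂ)
    (hχ : ∀ α : U, χ (Polynomial.aeval (MvPolynomial.X α) α.1) = 0) :
    ∃ χS : FinExt S →+* ℂ, ∀ q : MvPolynomial S A,
      χS (Ideal.Quotient.mk (relIdeal (finFamily S)) q) =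
        χ (MvPolynomial.rename (fun α : S => α.1) q) := by
  refine ⟨Ideal.Quotient.lift (relIdeal (finFamily S))
    (χ.comp (MvPolynomial.rename fun α : S => α.1 : MvPolynomial S A →ₐ[A] MvPolynomial U A))
    fun x hx => RingHom.mem_ker.1 ((Ideal.span_le.2 ?_ : relIdeal (finFamily S) ≤ _) hx),
    fun _ => rfl⟩
  rintro _ ⟨α, rfl⟩
  refine RingHom.mem_ker.2 ?_
  change χ (MvPolynomial.rename _ _) = 0
  rw [← Polynomial.aeval_algHom_apply, MvPolynomial.rename_X]
  exact hχ α.1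

/-- A homomorphism `A_S → ℂ` is the evaluation at a family of roots. -/
theorem exists_roots_of_finExt_ringHom (hU : IsMonicSet U) (χ : FinExt S →+* ℂ) (ev : A →+* ℂ)
    (hχ : ∀ a, χ (algebraMap A (FinExt S) a) = ev a) :
    ∃ l : U → ℂ, (∀ α : U, α.1.eval₂ ev (l α) = 0) ∧ ∀ q : MvPolynomial S A,
      MvPolynomial.eval₂Hom ev l (MvPolynomial.rename (fun α : S => α.1) q) =
        χ (Ideal.Quotient.mk (relIdeal (finFamily S)) q) := by
  classical
  have hroot : ∀ α : U, ∃ z : ℂ, α.1.eval₂ ev z = 0 := by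
    intro α
    obtain ⟨z, hz⟩ := IsAlgClosed.exists_root (α.1.map ev) (by
      rw [(hU α.1 α.2).1.degree_map]
      exact (Polynomial.natDegree_pos_iff_degree_pos.1 (hU α.1 α.2).2).ne')
    exact ⟨z, by rwa [Polynomial.IsRoot, Polynomial.eval_map] at hz⟩
  choose z hz using hroot
  -- Outside `S` any root will do, since polynomials in the indeterminates of `S` do not see it; a
  -- choice is needed to obtain a point with a coordinate for every `α ∈ U`.
  let l : U → ℂ := fun α => if h : α ∈ S then
    χ (Ideal.Quotient.mk (relIdeal (finFamily S)) (MvPolynomial.X ⟨α, h⟩)) else z α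
  have hev : χ.comp (algebraMap A (FinExt S)) = ev := RingHom.ext hχ
  refine ⟨l, fun α => ?_, fun q => ?_⟩
  · by_cases h : α ∈ S
    · have h0 : Ideal.Quotient.mk (relIdeal (finFamily S)) (Polynomial.aeval
          (MvPolynomial.X ⟨α, h⟩) (finFamily S ⟨α, h⟩)) = 0 :=
        Ideal.Quotient.eq_zero_iff_mem.2 (Ideal.subset_span ⟨⟨α, h⟩, rfl⟩)
      have h1 := congrArg χ h0
      rw [Polynomial.aeval_def, Polynomial.hom_eval₂, Polynomial.hom_eval₂, map_zero] at h1
      simp only [l, dif_pos h]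
      rw [← hev]
      exact h1
    · simp only [l, dif_neg h]
      exact hz α
  · induction q using MvPolynomial.induction_on with
    | C a =>
      rw [MvPolynomial.rename_C, MvPolynomial.coe_eval₂Hom, MvPolynomial.eval₂_C]
      exact (hχ a).symm
    | add p q hp hq => rw [map_add, map_add, hp, hq, map_add, map_add]
    | mul_X p α hp =>
      rw [map_mul, map_mul, hp, map_mul, map_mul, MvPolynomial.rename_X,
        MvPolynomial.coe_eval₂Hom, MvPolynomial.eval₂_X]
      simp only [l, dif_pos α.2]

/-- A character of the extension is bounded by the points that lie over a norming family of
characters of the base. -/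
theorem norm_apply_le_of_norming_eval₂ (hU : IsMonicSet U) {ι : Type*} (κ : ι → A →+* ℂ)
    (hκ : ∀ (a : A) (c : ℝ), 0 ≤ c → (∀ i, ‖κ i a‖ ≤ c) → ‖a‖ ≤ c) (q : MvPolynomial U A) {M : ℝ}
    (hM : 0 ≤ M) (hq : ∀ (i : ι) (l : U → ℂ), (∀ α : U, α.1.eval₂ (κ i) (l α) = 0) →
      ‖MvPolynomial.eval₂Hom (κ i) l q‖ ≤ M) (χ : MvPolynomial U A →+* ℂ)
    (hχ : ∀ α : U, χ (Polynomial.aeval (MvPolynomial.X α) α.1) = 0)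
    (hχn : ∀ a : A, ‖χ (MvPolynomial.C a)‖ ≤ ‖a‖) : ‖χ q‖ ≤ M := by
  obtain ⟨S, q, rfl⟩ := MvPolynomial.exists_finset_rename q
  have : Module.Free A (FinExt S) := free_quotient_relIdeal (hU.finFamily S)
  have : Module.Finite A (FinExt S) := finite_quotient_relIdeal (hU.finFamily S)
  obtain ⟨χS, hχS⟩ := exists_finExt_ringHom S χ hχ
  rw [← hχS]
  refine norm_apply_le_of_norming κ hκ hM (fun i χ' hχ' => ?_) χS fun a => ?_
  · obtain ⟨l, hl, hlq⟩ := exists_roots_of_finExt_ringHom S hU χ' (κ i) hχ'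
    rw [← hlq]
    exact hq i l hl
  · refine le_of_eq_of_le (congrArg _ ((hχS (MvPolynomial.C a)).trans ?_)) (hχn a)
    rw [MvPolynomial.rename_C]

end FiniteExtension

/-! ### The root space and its function algebra -/

section RootSpace

variable {X Y : Type*} [TopologicalSpace X] [TopologicalSpace Y] {A : Type u} [NormedCommRing A]
  [NormedAlgebra ℂ A] {U : Set (Polynomial A)}

/-- `Y`, with the projection `π` and the coordinate functions `c`, is the space of all families
`(κ, λ)` with `λ_α` a root of the polynomial `α` at the point `κ`. -/
structure IsRootSpace (ι : A →ₐ[ℂ] C(X, ℂ)) (π : C(Y, X)) (c : U → C(Y, ℂ)) : Prop where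
  sum_eq_zero : ∀ (y : Y) (α : U),
    ∑ k ∈ Finset.range (α.1.natDegree + 1), ι (α.1.coeff k) (π y) * c α y ^ k = 0
  exists_point : ∀ (x : X) (l : U → ℂ), (∀ α : U,
    ∑ k ∈ Finset.range (α.1.natDegree + 1), ι (α.1.coeff k) x * l α ^ k = 0) →
      ∃ y, π y = x ∧ ∀ α, c α y = l α

/-- The function on `Y` that a polynomial in all indeterminates defines. -/
def polyFun (ι : A →ₐ[ℂ] C(X, ℂ)) (π : C(Y, X)) (c : U → C(Y, ℂ)) :
    MvPolynomial U A →ₐ[ℂ] C(Y, ℂ) :=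
  MvPolynomial.aevalTower ((ContinuousMap.compRightAlgHom ℂ ℂ π).comp ι) c

variable {ι : A →ₐ[ℂ] C(X, ℂ)} {π : C(Y, X)} {c : U → C(Y, ℂ)}

theorem polyFun_C (f : A) : polyFun ι π c (MvPolynomial.C f) = (ι f).comp π :=
  MvPolynomial.aevalTower_C _ _ _

theorem polyFun_X (α : U) : polyFun ι π c (MvPolynomial.X α) = c α :=
  MvPolynomial.aevalTower_X _ _ _

theorem polyFun_apply_eq_eval₂Hom (q : MvPolynomial U A) (y : Y) :
    polyFun ι π c q y = MvPolynomial.eval₂Hom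
      ((ContinuousMap.evalAlgHom ℂ ℂ (π y)).comp ι : A →+* ℂ) (fun α => c α y) q := by
  induction q using MvPolynomial.induction_on with
  | C f =>
    rw [polyFun_C, MvPolynomial.coe_eval₂Hom, MvPolynomial.eval₂_C]
    rfl
  | add q q' hq hq' => rw [map_add, map_add, ContinuousMap.add_apply, hq, hq']
  | mul_X q α hq =>
    rw [map_mul, map_mul, ContinuousMap.mul_apply, hq, polyFun_X, MvPolynomial.coe_eval₂Hom,
      MvPolynomial.eval₂_X]

namespace IsRootSpace

theorem polyFun_reduce (h : IsRootSpace ι π c) (q : MvPolynomial U A) :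
    polyFun ι π c (reduce (fun α : U => α.1) q) = polyFun ι π c q := by
  refine map_reduce_of_roots (polyFun ι π c : MvPolynomial U A →+* C(Y, ℂ)) (fun α => ?_) q
  change polyFun ι π c _ = 0
  ext y
  rw [Polynomial.aeval_eq_sum_range, map_sum, ContinuousMap.coe_sum, Finset.sum_apply]
  refine Eq.trans (Finset.sum_congr rfl fun k _ => ?_) (h.sum_eq_zero y α)
  rw [MvPolynomial.smul_eq_C_mul, map_mul, map_pow, polyFun_C, polyFun_X]
  rfl

variable [CompactSpace X]

/-- With `d` the degree, a root `z` satisfies `1 ≤ ∑ ‖a_k‖ |z| ^ (k - d)`, while the condition on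
`t` reads `∑ ‖a_k‖ t ^ (k - d) ≤ 1`. All exponents are at most `-1`, so `|z| > t` would make the
first sum at most `t / |z| < 1`. The proof clears denominators. -/
theorem norm_coord_le (h : IsRootSpace ι π c) (hU : IsMonicSet U) {t : U → ℝ}
    (ht : IsNormParameter U t) (hι : ∀ a, ‖ι a‖ = ‖a‖) (y : Y) (α : U) : ‖c α y‖ ≤ t α := by
  obtain ⟨ht0, hts⟩ := ht α
  obtain ⟨hm, hd⟩ := hU α.1 α.2
  have hp := h.sum_eq_zero y α
  rw [Finset.sum_range_succ, hm.coeff_natDegree, map_one] at hp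
  obtain ⟨n, hn⟩ : ∃ n, α.1.natDegree = n + 1 := ⟨α.1.natDegree - 1, by omega⟩
  rw [hn] at hp hts
  set z := c α y
  by_contra! hlt
  have hz0 : 0 < ‖z‖ := ht0.trans hlt
  have hz : ‖z‖ ^ (n + 1) ≤ ∑ k ∈ Finset.range (n + 1), ‖α.1.coeff k‖ * ‖z‖ ^ k := by
    have hp' : z ^ (n + 1) =
        -∑ k ∈ Finset.range (n + 1), ι (α.1.coeff k) (π y) * z ^ k := by
      rw [eq_neg_iff_add_eq_zero, add_comm]
      simpa using hp
    rw [← norm_pow, hp', norm_neg]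
    refine (norm_sum_le _ _).trans (Finset.sum_le_sum fun k _ => ?_)
    rw [norm_mul, norm_pow, ← hι]
    exact mul_le_mul_of_nonneg_right (ContinuousMap.norm_coe_le_norm _ _) (by positivity)
  -- The degree is `n + 1` but the factors multiplied in have exponent `n`: this is enough for the
  -- terms with `k ≤ n` and leaves one spare factor for the strict inequality.
  have hlt' : t α ^ (n + 1) * ‖z‖ ^ n < ‖z‖ ^ (n + 1) * t α ^ n := by
    calc t α ^ (n + 1) * ‖z‖ ^ n = t α ^ n * ‖z‖ ^ n * t α := by ring
      _ < t α ^ n * ‖z‖ ^ n * ‖z‖ := by gcongr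
      _ = _ := by ring
  have hle : (∑ k ∈ Finset.range (n + 1), ‖α.1.coeff k‖ * ‖z‖ ^ k) * t α ^ n ≤
      (∑ k ∈ Finset.range (n + 1), ‖α.1.coeff k‖ * t α ^ k) * ‖z‖ ^ n := by
    rw [Finset.sum_mul, Finset.sum_mul]
    refine Finset.sum_le_sum fun k hk => ?_
    obtain ⟨m, hm⟩ := Nat.exists_eq_add_of_le (Nat.lt_succ_iff.1 (Finset.mem_range.1 hk))
    calc ‖α.1.coeff k‖ * ‖z‖ ^ k * t α ^ n
        = ‖α.1.coeff k‖ * ‖z‖ ^ k * t α ^ k * t α ^ m := by rw [hm, pow_add]; ring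
      _ ≤ ‖α.1.coeff k‖ * ‖z‖ ^ k * t α ^ k * ‖z‖ ^ m := by gcongr
      _ = ‖α.1.coeff k‖ * t α ^ k * ‖z‖ ^ n := by rw [hm, pow_add]; ring
  have h2 : ‖z‖ ^ (n + 1) * t α ^ n ≤ t α ^ (n + 1) * ‖z‖ ^ n :=
    (mul_le_mul_of_nonneg_right hz (by positivity)).trans
      (hle.trans (mul_le_mul_of_nonneg_right hts (by positivity)))
  exact absurd h2 hlt'.not_ge

/-- After reduction, which does not change the function, the estimate holds term by term. It makes
evaluation at `y` contractive for the norm of the extension, so that `y` defines a character. -/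
theorem norm_polyFun_apply_le (h : IsRootSpace ι π c) (hU : IsMonicSet U) {t : U → ℝ}
    (ht : IsNormParameter U t) (hι : ∀ a, ‖ι a‖ = ‖a‖) (q : MvPolynomial U A) (y : Y) :
    ‖polyFun ι π c q y‖ ≤ weightedNorm t (reduce (fun α : U => α.1) q) := by
  rw [← h.polyFun_reduce]
  generalize reduce (fun α : U => α.1) q = q'
  conv_lhs => rw [q'.as_sum, map_sum, ContinuousMap.coe_sum, Finset.sum_apply]
  refine (norm_sum_le _ _).trans (Finset.sum_le_sum fun s _ => ?_)
  rw [MvPolynomial.monomial_eq, map_mul, ContinuousMap.mul_apply, norm_mul, polyFun_C, ← hι]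
  refine mul_le_mul (ContinuousMap.norm_coe_le_norm (ι (q'.coeff s)) _) ?_ (norm_nonneg _)
    (norm_nonneg _)
  rw [Finsupp.prod, map_prod, ContinuousMap.coe_prod, Finset.prod_apply, norm_prod]
  refine Finset.prod_le_prod (fun _ _ => norm_nonneg _) fun α _ => ?_
  rw [map_pow, polyFun_X, ContinuousMap.pow_apply, norm_pow]
  exact pow_le_pow_left₀ (norm_nonneg _) (h.norm_coord_le hU ht hι y α) _

variable [CompactSpace Y]

/-- The values of a polynomial at the characters of the extension are bounded by its values on
the root space. -/
theorem norm_le_norm_polyFun (h : IsRootSpace ι π c) (hU : IsMonicSet U)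
    (hι : ∀ a, ‖ι a‖ = ‖a‖) (χ : MvPolynomial U A →+* ℂ)
    (hχ : ∀ α : U, χ (Polynomial.aeval (MvPolynomial.X α) α.1) = 0)
    (hχn : ∀ f : A, ‖χ (MvPolynomial.C f)‖ ≤ ‖f‖) (q : MvPolynomial U A) :
    ‖χ q‖ ≤ ‖polyFun ι π c q‖ := by
  -- The points of `X` form a norming family because `ι` is isometric; the character of `A` below
  -- `χ` need not be one of them.
  refine norm_apply_le_of_norming_eval₂ hU
    (fun x : X => ((ContinuousMap.evalAlgHom ℂ ℂ x).comp ι : A →+* ℂ)) (fun f C hC hf => ?_)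
    q (norm_nonneg _) (fun x l hl => ?_) χ hχ hχn
  · rw [← hι]
    exact (ContinuousMap.norm_le _ hC).2 hf
  · obtain ⟨y, rfl, hy⟩ := h.exists_point x l fun α => by
      rw [← hl α, Polynomial.eval₂_eq_sum_range]
      rfl
    obtain rfl : (fun α => c α y) = l := funext hy
    rw [← polyFun_apply_eq_eval₂Hom]
    exact ContinuousMap.norm_coe_le_norm _ _

end IsRootSpace

end RootSpace

/-! ### Characters and closures of Gelfand transforms -/

section Characters

open WeakDual

variable {B : Type*} [NormedCommRing B] [NormedAlgebra ℂ B]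

/-- If `y < x`, then `C * (y / x) ^ n` tends to `0` but stays at least `1`. Only positive exponents
are required, because `‖1‖` may exceed `1` in a normed ring. -/
theorem le_of_forall_pow_le_const_mul {x y C : ℝ} (hy : 0 ≤ y)
    (h : ∀ n : ℕ, 0 < n → x ^ n ≤ C * y ^ n) : x ≤ y := by
  by_contra! hlt
  have hx0 : 0 < x := hy.trans_lt hlt
  have h1 : ∀ n : ℕ, 1 ≤ C * (y / x) ^ (n + 1) := by
    intro n
    rw [div_pow, ← mul_div_assoc, one_le_div (by positivity)]
    exact h (n + 1) n.succ_pos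
  have h2 : Filter.Tendsto (fun n : ℕ => C * (y / x) ^ (n + 1)) Filter.atTop (nhds (C * 0)) :=
    ((tendsto_pow_atTop_nhds_zero_of_lt_one (by positivity) ((div_lt_one hx0).2 hlt)).comp
      (Filter.tendsto_add_atTop_nat 1)).const_mul C
  have := ge_of_tendsto' h2 h1
  norm_num at this

/-- Continuous characters of a (possibly incomplete) normed algebra are contractive. -/
theorem norm_character_le (φ : characterSpace ℂ B) (b : B) : ‖φ b‖ ≤ ‖b‖ := by
  obtain ⟨C, -, hC⟩ := (toStrongDual (φ : WeakDual ℂ B)).isBoundedLinearMap.bound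
  have hC' : ∀ x : B, ‖φ x‖ ≤ C * ‖x‖ := hC
  refine le_of_forall_pow_le_const_mul (C := max C 0) (norm_nonneg _)
    fun n hn => ?_
  rw [← norm_pow, ← map_pow]
  exact (hC' _).trans (mul_le_mul (le_max_left _ _) (norm_pow_le' b hn) (norm_nonneg _)
    (le_max_right _ _))

theorem continuous_gelfandTransform : Continuous (gelfandTransform ℂ B) :=
  AddMonoidHomClass.continuous_of_bound _ 1 fun b => by
    rw [one_mul]
    exact (ContinuousMap.norm_le _ (norm_nonneg b)).2 fun φ => norm_character_le φ b

/-- A contractive homomorphism to `ℂ` is a point of the character space. -/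
theorem exists_character_eq (Φ : B →ₐ[ℂ] ℂ) (hΦ : ∀ b, ‖Φ b‖ ≤ ‖b‖) :
    ∃ φ : characterSpace ℂ B, ∀ b, φ b = Φ b := by
  refine ⟨⟨StrongDual.toWeakDual (Φ.toLinearMap.mkContinuous 1 (by simpa using hΦ)), ?_, ?_⟩,
    fun b => rfl⟩
  · intro h
    have h1 : Φ 1 = 0 := DFunLike.congr_fun h (1 : B)
    rw [map_one] at h1
    exact one_ne_zero h1
  · exact fun x y => map_mul Φ x y

variable {D : Type*} [CommRing D] [Algebra ℂ D]

theorem denseRange_gelfandClosure_of (φ : D →ₐ[ℂ] B) (hφ : DenseRange φ) :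
    DenseRange (((gelfandTransform ℂ B).comp φ).codRestrict (gelfandClosure B)
      fun d => (gelfandClosure.of (φ d)).2) := by
  refine denseRange_codRestrict _ _ _ (closure_minimal ?_ isClosed_closure)
  rintro _ ⟨b, rfl⟩
  refine closure_mono ?_ (continuous_gelfandTransform.range_subset_closure_image_dense hφ ⟨b, rfl⟩)
  rintro _ ⟨_, ⟨d, rfl⟩, rfl⟩
  exact ⟨d, rfl⟩

/-- Evaluation at `y` is dominated by `φ`, so it extends along the dense image of `φ` to a character
of `B`; each value of `g d` is therefore a value of the Gelfand transform of `φ d`. -/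
theorem norm_le_norm_gelfandTransform {Y : Type*} [TopologicalSpace Y] [CompactSpace Y]
    (g : D →ₐ[ℂ] C(Y, ℂ)) (φ : D →ₐ[ℂ] B) (hφ : DenseRange φ) (h : ∀ d y, ‖g d y‖ ≤ ‖φ d‖)
    (d : D) : ‖g d‖ ≤ ‖gelfandTransform ℂ B (φ d)‖ := by
  refine (ContinuousMap.norm_le _ (norm_nonneg _)).2 fun y => ?_
  obtain ⟨Φ, hΦ, hΦφ⟩ := exists_algHom_extension φ
    ((ContinuousMap.evalAlgHom ℂ ℂ y).comp g) hφ fun d => h d y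
  obtain ⟨χ, hχ⟩ := exists_character_eq Φ hΦ
  have h : g d y = gelfandTransform ℂ B (φ d) χ := (hΦφ d).symm.trans (hχ _).symm
  rw [h]
  exact ContinuousMap.norm_coe_le_norm _ _

/-- A closed algebra of functions is isometrically isomorphic to the closure of the Gelfand
transforms of `B` if both contain dense images of one algebra that induce the same seminorm. -/
theorem exists_gelfandClosure_algEquiv {Y : Type*} [TopologicalSpace Y] [CompactSpace Y]
    (g : D →ₐ[ℂ] C(Y, ℂ)) (s : Set C(Y, ℂ)) (hs : s ⊆ Set.range g)
    (hg : ∀ d, g d ∈ (Algebra.adjoin ℂ s).topologicalClosure) (φ : D →ₐ[ℂ] B)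
    (hφ : DenseRange φ) (hle : ∀ d y, ‖g d y‖ ≤ ‖φ d‖)
    (hge : ∀ (χ : characterSpace ℂ B) (d : D), ‖χ (φ d)‖ ≤ ‖g d‖) :
    ∃ Θ : (Algebra.adjoin ℂ s).topologicalClosure ≃ₐ[ℂ] gelfandClosure B, Isometry Θ ∧
      ∀ (x : (Algebra.adjoin ℂ s).topologicalClosure) (d : D), g d = x →
        Θ x = gelfandClosure.of (φ d) := by
  have : CompleteSpace (Algebra.adjoin ℂ s).topologicalClosure :=
    (Subalgebra.isClosed_topologicalClosure _).completeSpace_coe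
  have : CompleteSpace (gelfandClosure B) :=
    (Subalgebra.isClosed_topologicalClosure _).completeSpace_coe
  have hsg : Algebra.adjoin ℂ s ≤ g.range := Algebra.adjoin_le hs
  obtain ⟨Θ, hΘ, h⟩ := exists_isometric_algEquiv
    (g.codRestrict (Algebra.adjoin ℂ s).topologicalClosure hg)
    (((gelfandTransform ℂ B).comp φ).codRestrict (gelfandClosure B)
      fun d => (gelfandClosure.of (φ d)).2)
    (denseRange_codRestrict _ _ _ (closure_mono hsg)) (denseRange_gelfandClosure_of φ hφ)
    fun d => (norm_le_norm_gelfandTransform g φ hφ hle d).antisymm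
      ((ContinuousMap.norm_le _ (norm_nonneg _)).2 fun χ => hge χ d)
  exact ⟨Θ, hΘ, fun x d hx => (congrArg Θ (Subtype.ext hx.symm)).trans (h d)⟩

end Characters

/-! ### The function algebra of the root space as a closure of Gelfand transforms -/

section RootSpaceGelfand

variable {X Y : Type*} [TopologicalSpace X] [TopologicalSpace Y] [CompactSpace Y]
  {A : Type u} [NormedCommRing A] [NormedAlgebra ℂ A] {U : Set (Polynomial A)}
  {ι : A →ₐ[ℂ] C(X, ℂ)} {π : C(Y, X)} {c : U → C(Y, ℂ)}

theorem polyFun_mem_topologicalClosure (q : MvPolynomial U A) :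
    polyFun ι π c q ∈ (Algebra.adjoin ℂ
      (Set.range (fun f : A => (ι f).comp π) ∪ Set.range c)).topologicalClosure := by
  refine Subalgebra.le_topologicalClosure _ ?_
  induction q using MvPolynomial.induction_on with
  | C f =>
    rw [polyFun_C]
    exact Algebra.subset_adjoin (Or.inl ⟨f, rfl⟩)
  | add p q hp hq =>
    rw [map_add]
    exact Subalgebra.add_mem _ hp hq
  | mul_X p α hp =>
    rw [map_mul, polyFun_X]
    exact Subalgebra.mul_mem _ hp (Algebra.subset_adjoin (Or.inr ⟨α, rfl⟩))

variable [CompactSpace X] {B : Type*} [NormedCommRing B] [NormedAlgebra ℂ B]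

/-- The closed algebra generated by the coordinate functions on the root space is the closure of the
Gelfand transforms of any normed algebra in which the polynomials modulo the relations, with the
weighted norm, are dense. -/
theorem IsRootSpace.exists_algEquiv (h : IsRootSpace ι π c) (hU : IsMonicSet U) {t : U → ℝ}
    (ht : IsNormParameter U t) (hι : ∀ a, ‖ι a‖ = ‖a‖)
    (φ : MvPolynomial U A →ₐ[ℂ] B) (hφ : DenseRange φ)
    (hφn : ∀ q, ‖φ q‖ = weightedNorm t (reduce (fun α : U => α.1) q)) :
    ∃ Θ : (Algebra.adjoin ℂ (Set.range (fun f : A => (ι f).comp π) ∪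
        Set.range c)).topologicalClosure ≃ₐ[ℂ] gelfandClosure B, Isometry Θ ∧
      (∀ (f : A) x, (ι f).comp π = x.1 → Θ x = gelfandClosure.of (φ (MvPolynomial.C f))) ∧
      ∀ (α : U) x, c α = x.1 → Θ x = gelfandClosure.of (φ (MvPolynomial.X α)) := by
  obtain ⟨Θ, hΘ, hΘφ⟩ := exists_gelfandClosure_algEquiv (polyFun ι π c)
    (Set.range (fun f : A => (ι f).comp π) ∪ Set.range c) (by
      rintro _ (⟨f, rfl⟩ | ⟨α, rfl⟩)
      · exact ⟨MvPolynomial.C f, polyFun_C f⟩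
      · exact ⟨MvPolynomial.X α, polyFun_X α⟩) polyFun_mem_topologicalClosure φ hφ
    (fun q y => (h.norm_polyFun_apply_le hU ht hι q y).trans_eq (hφn q).symm) fun χ q => by
      refine h.norm_le_norm_polyFun hU hι
        (((WeakDual.CharacterSpace.toAlgHom χ).comp φ : MvPolynomial U A →ₐ[ℂ] ℂ) :
          MvPolynomial U A →+* ℂ) (fun α => ?_) (fun f => ?_) q
      -- The relations reduce to `0`, so they have norm `0` in `B` and vanish at every character.
      · have h : φ (Polynomial.aeval (MvPolynomial.X α) α.1) = 0 := by
          rw [← norm_eq_zero, hφn, reduce_eq_zero hU.family (Ideal.subset_span ⟨α, rfl⟩),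
            weightedNorm_zero]
        change χ (φ _) = 0
        rw [h, map_zero]
      · refine (norm_character_le χ (φ _)).trans ?_
        rw [hφn]
        refine (weightedNorm_reduce_le hU.family ht _).trans_eq ?_
        rw [MvPolynomial.C_apply, weightedNorm_monomial, Finsupp.prod_zero_index, mul_one]
  exact ⟨Θ, hΘ, fun f x hx => hΘφ x _ ((polyFun_C f).trans hx),
    fun α x hx => hΘφ x _ ((polyFun_X α).trans hx)⟩

end RootSpaceGelfand

/-! ### Comparison of the Narmania, standard and Cole extensions -/

section Presentations

variable {A : Type u} [NormedCommRing A] [NormedAlgebra ℂ A] {U : Set (Polynomial A)}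
  (hU : IsMonicSet U) {t : U → ℝ} (ht : IsNormParameter U t)

/-- The map from the polynomials in all indeterminates to the Narmania extension. -/
def NarmaniaExt.ofPoly : MvPolynomial U A →ₐ[ℂ] NarmaniaExt hU ht :=
  { (UniformSpace.Completion.coeRingHom : LimitExt hU ht →+* NarmaniaExt hU ht).comp
      (LimitExt.ofPoly hU ht : MvPolynomial U A →+* LimitExt hU ht) with
    commutes' := fun c => congrArg (fun x : LimitExt hU ht => (x : NarmaniaExt hU ht))
      ((LimitExt.ofPoly hU ht).commutes c) }

theorem NarmaniaExt.ofPoly_C (a : A) :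
    NarmaniaExt.ofPoly hU ht (MvPolynomial.C a) = NarmaniaExt.inclusion hU ht a :=
  congrArg (fun x : LimitExt hU ht => (x : NarmaniaExt hU ht)) (LimitExt.ofPoly_C hU ht a)

theorem NarmaniaExt.ofPoly_X (α : U) :
    NarmaniaExt.ofPoly hU ht (MvPolynomial.X α) = NarmaniaExt.root hU ht α :=
  congrArg (fun x : LimitExt hU ht => (x : NarmaniaExt hU ht)) (LimitExt.ofPoly_X hU ht α)

theorem NarmaniaExt.denseRange_ofPoly : DenseRange (NarmaniaExt.ofPoly hU ht) :=
  UniformSpace.Completion.denseRange_coe.comp (LimitExt.ofPoly_surjective hU ht).denseRange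
    (UniformSpace.Completion.continuous_coe _)

theorem NarmaniaExt.norm_ofPoly (q : MvPolynomial U A) :
    ‖NarmaniaExt.ofPoly hU ht q‖ = weightedNorm t (reduce (fun α : U => α.1) q) :=
  (UniformSpace.Completion.norm_coe _).trans (LimitExt.norm_ofPoly hU ht q)

variable {hU ht} {r : U → U → Prop} {B : Type*} [NormedCommRing B] [NormedAlgebra ℂ B]
  [Algebra A B] [IsScalarTower ℂ A B]

/-- The map from the polynomials in all indeterminates to a standard extension. -/
def StandardExtension.ofPoly (E : StandardExtension hU t r B) : MvPolynomial U A →ₐ[ℂ] B :=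
  (MvPolynomial.aeval E.root).restrictScalars ℂ

theorem StandardExtension.ofPoly_C (E : StandardExtension hU t r B) (a : A) :
    E.ofPoly (MvPolynomial.C a) = algebraMap A B a :=
  MvPolynomial.aeval_C _ _

theorem StandardExtension.ofPoly_X (E : StandardExtension hU t r B) (α : U) :
    E.ofPoly (MvPolynomial.X α) = E.root α :=
  MvPolynomial.aeval_X _ _

/-- The completion of a standard extension is the Narmania extension. -/
theorem StandardExtension.exists_completion_algEquiv [IsWellOrder U r]
    (E : StandardExtension hU t r B) :
    ∃ Φ : UniformSpace.Completion B ≃ₐ[ℂ] NarmaniaExt hU ht, Isometry Φ ∧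
      (∀ a : A, Φ ((algebraMap A B a : B) : UniformSpace.Completion B) =
        NarmaniaExt.inclusion hU ht a) ∧
      ∀ α : U, Φ ((E.root α : B) : UniformSpace.Completion B) = NarmaniaExt.root hU ht α := by
  let g : MvPolynomial U A →ₐ[ℂ] UniformSpace.Completion B :=
    { (UniformSpace.Completion.coeRingHom : B →+* UniformSpace.Completion B).comp
        (E.ofPoly : MvPolynomial U A →+* B) with
      commutes' := fun c => congrArg (fun x : B => (x : UniformSpace.Completion B))
        (E.ofPoly.commutes c) }
  have hg : ∀ q, g q = (E.ofPoly q : UniformSpace.Completion B) := fun _ => rfl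
  obtain ⟨Φ, hΦ, h⟩ := exists_isometric_algEquiv g (NarmaniaExt.ofPoly hU ht)
    (UniformSpace.Completion.denseRange_coe.comp E.aeval_surjective.denseRange
      (UniformSpace.Completion.continuous_coe _))
    (NarmaniaExt.denseRange_ofPoly hU ht) fun q => by
      rw [hg, UniformSpace.Completion.norm_coe, NarmaniaExt.norm_ofPoly]
      exact E.norm_aeval q
  refine ⟨Φ, hΦ, fun a => ?_, fun α => ?_⟩
  · rw [← E.ofPoly_C, ← hg, h, NarmaniaExt.ofPoly_C]
  · rw [← E.ofPoly_X, ← hg, h, NarmaniaExt.ofPoly_X]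

/-- The closure of the Gelfand transforms of the Narmania extension is the closed algebra generated
by the coordinate functions on the root space. -/
theorem IsRootSpace.exists_narmaniaExt_algEquiv {X Y : Type*} [TopologicalSpace X] [CompactSpace X]
    [TopologicalSpace Y] [CompactSpace Y] {ι : A →ₐ[ℂ] C(X, ℂ)} {π : C(Y, X)} {c : U → C(Y, ℂ)}
    (h : IsRootSpace ι π c) (hU : IsMonicSet U) (ht : IsNormParameter U t)
    (hι : ∀ a, ‖ι a‖ = ‖a‖) :
    ∃ Θ : (Algebra.adjoin ℂ (Set.range (fun f : A => (ι f).comp π) ∪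
        Set.range c)).topologicalClosure ≃ₐ[ℂ] gelfandClosure (NarmaniaExt hU ht), Isometry Θ ∧
      (∀ (f : A) x, (ι f).comp π = x.1 →
        Θ x = gelfandClosure.of (NarmaniaExt.inclusion hU ht f)) ∧
      ∀ (α : U) x, c α = x.1 → Θ x = gelfandClosure.of (NarmaniaExt.root hU ht α) := by
  obtain ⟨Θ, hΘ, hC, hX⟩ := h.exists_algEquiv hU ht hι (NarmaniaExt.ofPoly hU ht)
    (NarmaniaExt.denseRange_ofPoly hU ht) (NarmaniaExt.norm_ofPoly hU ht)
  refine ⟨Θ, hΘ, fun f x hx => ?_, fun α x hx => ?_⟩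
  · rw [hC f x hx, NarmaniaExt.ofPoly_C]
  · rw [hX α x hx, NarmaniaExt.ofPoly_X]

/-- The closure of the Gelfand transforms of a standard extension is the closed algebra generated
by the coordinate functions on the root space. -/
theorem IsRootSpace.exists_standardExtension_algEquiv {X Y : Type*} [TopologicalSpace X]
    [CompactSpace X] [TopologicalSpace Y] [CompactSpace Y] {ι : A →ₐ[ℂ] C(X, ℂ)} {π : C(Y, X)}
    {c : U → C(Y, ℂ)} (h : IsRootSpace ι π c) (ht : IsNormParameter U t) (hι : ∀ a, ‖ι a‖ = ‖a‖)
    [IsWellOrder U r] (E : StandardExtension hU t r B) :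
    ∃ Θ : (Algebra.adjoin ℂ (Set.range (fun f : A => (ι f).comp π) ∪
        Set.range c)).topologicalClosure ≃ₐ[ℂ] gelfandClosure B, Isometry Θ ∧
      (∀ (f : A) x, (ι f).comp π = x.1 → Θ x = gelfandClosure.of (algebraMap A B f)) ∧
      ∀ (α : U) x, c α = x.1 → Θ x = gelfandClosure.of (E.root α) := by
  obtain ⟨Θ, hΘ, hC, hX⟩ := h.exists_algEquiv hU ht hι E.ofPoly E.aeval_surjective.denseRange
    E.norm_aeval
  refine ⟨Θ, hΘ, fun f x hx => ?_, fun α x hx => ?_⟩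
  · rw [hC f x hx, E.ofPoly_C]
  · rw [hX α x hx, E.ofPoly_X]

end Presentations

theorem isRootSpace_coleSpace {X : Type u} [TopologicalSpace X] [CompactSpace X]
    {A : Subalgebra ℂ C(X, ℂ)} {U : Set (Polynomial A)} (hU : IsMonicSet U) :
    IsRootSpace A.val (ColeSpace.proj hU) (ColeSpace.coord hU) where
  sum_eq_zero y := y.2
  exists_point x l h := ⟨⟨(x, l), h⟩, rfl, fun _ => rfl⟩

end AlgExt

end

set_option maxHeartbeats 1000000 in
theorem proposition1p6p3 :
    (∀ (A : Type u) [NormedCommRing A] [NormedAlgebra ℂ A] [CompleteSpace A]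
      (U : Set (Polynomial A)) (hU : AlgExt.IsMonicSet U)
      (t : U → ℝ) (ht : AlgExt.IsNormParameter U t)
      (r : U → U → Prop) [IsWellOrder U r],
      (∃ (B : Type u) (_ : NormedCommRing B) (_ : NormedAlgebra ℂ B) (_ : Algebra A B)
        (_ : IsScalarTower ℂ A B), Nonempty (AlgExt.StandardExtension hU t r B)) ∧
      ∀ (B : Type v) [NormedCommRing B] [NormedAlgebra ℂ B] [Algebra A B] [IsScalarTower ℂ A B]
        (E : AlgExt.StandardExtension hU t r B),
        ∃ Φ : UniformSpace.Completion B ≃ₐ[ℂ] AlgExt.NarmaniaExt hU ht,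
          Isometry Φ ∧
          (∀ a : A, Φ ((algebraMap A B a : B) : UniformSpace.Completion B) =
            AlgExt.NarmaniaExt.inclusion hU ht a) ∧
          ∀ α : U, Φ ((E.root α : B) : UniformSpace.Completion B) =
            AlgExt.NarmaniaExt.root hU ht α) ∧
    (∀ (X : Type u) [TopologicalSpace X] [CompactSpace X] [T2Space X]
      (A : Subalgebra ℂ C(X, ℂ)) (_ : AlgExt.IsUniformAlgebra A)
      (U : Set (Polynomial A)) (hU : AlgExt.IsMonicSet U)
      (t : U → ℝ) (ht : AlgExt.IsNormParameter U t),
      (∃ Ψ : AlgExt.coleExt hU ≃ₐ[ℂ] AlgExt.gelfandClosure (AlgExt.NarmaniaExt hU ht),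
        Isometry Ψ ∧
        (∀ f : A, Ψ (AlgExt.coleExt.inclusion hU f) =
          AlgExt.gelfandClosure.of (AlgExt.NarmaniaExt.inclusion hU ht f)) ∧
        ∀ α : U, Ψ (AlgExt.coleExt.root hU α) =
          AlgExt.gelfandClosure.of (AlgExt.NarmaniaExt.root hU ht α)) ∧
      ∀ (r : U → U → Prop) [IsWellOrder U r]
        (B : Type v) [NormedCommRing B] [NormedAlgebra ℂ B] [Algebra A B] [IsScalarTower ℂ A B]
        (E : AlgExt.StandardExtension hU t r B),
        ∃ Θ : AlgExt.coleExt hU ≃ₐ[ℂ] AlgExt.gelfandClosure B,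
          Isometry Θ ∧
          (∀ f : A, Θ (AlgExt.coleExt.inclusion hU f) =
            AlgExt.gelfandClosure.of (algebraMap A B f)) ∧
          ∀ α : U, Θ (AlgExt.coleExt.root hU α) = AlgExt.gelfandClosure.of (E.root α)) := by
  refine ⟨fun A _ _ _ U hU t ht r _ => ⟨?_, ?_⟩, fun X _ _ _ A _ U hU t ht => ⟨?_, ?_⟩⟩
  -- One normed algebra serves for every well-ordering; only its filtration by subalgebras depends
  -- on `r`.
  · exact ⟨AlgExt.LimitExt hU ht, inferInstance, inferInstance, inferInstance, inferInstance,
      ⟨AlgExt.LimitExt.standardExtension hU ht r⟩⟩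
  · intro B _ _ _ _ E
    exact E.exists_completion_algEquiv
  · obtain ⟨Ψ, hΨ, hC, hX⟩ := (AlgExt.isRootSpace_coleSpace hU).exists_narmaniaExt_algEquiv hU ht
      fun _ => rfl
    exact ⟨Ψ, hΨ, fun f => hC f _ rfl, fun α => hX α _ rfl⟩
  · intro r _ B _ _ _ _ E
    obtain ⟨Θ, hΘ, hC, hX⟩ :=
      (AlgExt.isRootSpace_coleSpace hU).exists_standardExtension_algEquiv ht (fun _ => rfl) E
    exact ⟨Θ, hΘ, fun f => hC f _ rfl, fun α => hX α _ rfl⟩
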